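/- Let $p>1$, $Q>1$. For $t\in(0,1]$ the equation $(1-pv)^{1/p}(1-v)^{-1}=t$ has exactly one solution $v=v_p^+(t)$ in $[0,1/p]$ and exactly one solution $v=v_p^-(t)$ in $(-\infty,0]$; put $s_p^{\pm}(Q):=v_p^{\pm}(1/Q)$. For a Radon measure $\mu$ on $\mathbb{R}^n$, a weight is a function $w\in L^1_{loc}(\mu)$ that is positive $\mu$-a.e., and $\langle f\rangle_R:=\mu(R)^{-1}\int_R f\,d\mu$. With suprema over all rectangular boxes $R\subset\mathbb{R}^n$ with edges parallel to the axes and $\mu(R)>0$, put $$[w]_{q}:=\sup_R\langle w\rangle_R\,\langle w^{-1/(q-1)}\rangle_R^{\,q-1}\quad(q>1),\qquad [w]_{RH_q}:=\sup_R\langle w^q\rangle_R^{1/q}\langle w\rangle_R^{-1}\quad(q\ge 1),$$ and write $w\in A_q^*$ if $[w]_q<\infty$ and $w\in RH_q^*$ if $[w]_{RH_q}<\infty$. Theorem. Let $\mu$ be a Radon measure on $\mathbb{R}^n$ with $\mu(H)=0$ for every hyperplane $H$ orthogonal to one of the coordinate axes. Then for every weight $w$ with $[w]_{RH_p}=Q$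 we have $$w\in A_q^*\quad\text{for } 1-s_p^-(Q)<q<\infty,\qquad\text{and}\qquad w\in RH_q^*\quad\text{for } 1\le q<1/s_p^+(Q).$$ Moreover $[w]_q$, respectively $[w]_{RH_q}$, is bounded by a constant that depends only on $p$, $Q$ and $q$ (not on $n$, $\mu$ or $w$). The ranges of $q$ are sharp for $n=1$ and $\mu=dx$: for every $q$ with $1<q\le 1-s_p^-(Q)$ there is a weight $w$ on $\mathbb{R}$ with $[w]_{RH_p}=Q$ and $w\notin A_q^*$, and for every $q\ge 1/s_p^+(Q)$ there is a weight $w$ on $\mathbb{R}$ with $[w]_{RH_p}=Q$ and $w\notin RH_q^*$. -/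

import Mathlib

open MeasureTheory Set
open scoped ENNReal NNReal

/-- A weight on `ℝⁿ` with respect to `μ`: a locally integrable function that is positive
`μ`-almost everywhere. -/
structure IsWeight {n : ℕ} (μ : Measure (Fin n → ℝ)) (w : (Fin n → ℝ) → ℝ) : Prop where
  locallyIntegrable : LocallyIntegrable w μ
  pos : ∀ᵐ x ∂μ, 0 < w x

/-- The average over `R` of a function that is nonnegative `μ`-almost everywhere, as an extended
nonnegative number. -/
noncomputable def avg {n : ℕ} (μ : Measure (Fin n → ℝ)) (R : Set (Fin n → ℝ))
    (f : (Fin n → ℝ) → ℝ) : ℝ≥0∞ :=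
  (∫⁻ x in R, ENNReal.ofReal (f x) ∂μ) / μ R

/-- The rectangular boxes with edges parallel to the axes that have positive measure (so that
averages over them are meaningful). -/
def boxes {n : ℕ} (μ : Measure (Fin n → ℝ)) : Set (Set (Fin n → ℝ)) :=
  {R | (∃ a b : Fin n → ℝ, (∀ i, a i < b i) ∧ R = Set.Icc a b) ∧ 0 < μ R}

/-- The strong Muckenhoupt characteristic of exponent `q`. -/
noncomputable def strongAChar {n : ℕ} (μ : Measure (Fin n → ℝ)) (q : ℝ)
    (w : (Fin n → ℝ) → ℝ) : ℝ≥0∞ :=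
  ⨆ R ∈ boxes μ, avg μ R w * avg μ R (fun x => w x ^ (-1 / (q - 1))) ^ (q - 1)

/-- The strong Reverse Hölder characteristic of exponent `q`. -/
noncomputable def strongRHChar {n : ℕ} (μ : Measure (Fin n → ℝ)) (q : ℝ)
    (w : (Fin n → ℝ) → ℝ) : ℝ≥0∞ :=
  ⨆ R ∈ boxes μ, avg μ R (fun x => w x ^ q) ^ (1 / q) * (avg μ R w)⁻¹

/-- `w` belongs to the strong Muckenhoupt class of exponent `q`. -/
def MemStrongA {n : ℕ} (μ : Measure (Fin n → ℝ)) (q : ℝ) (w : (Fin n → ℝ) → ℝ) : Prop :=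
  strongAChar μ q w < ∞

/-- `w` belongs to the strong Reverse Hölder class of exponent `q`. -/
def MemStrongRH {n : ℕ} (μ : Measure (Fin n → ℝ)) (q : ℝ) (w : (Fin n → ℝ) → ℝ) : Prop :=
  strongRHChar μ q w < ∞

/-- The left-hand side of the equation `(1 - p v)^(1/p) (1 - v)⁻¹ = t`. -/
noncomputable def rootFun (p v : ℝ) : ℝ := (1 - p * v) ^ (1 / p) * (1 - v)⁻¹

/-- The solution `v ∈ [0, 1/p]` of `(1 - p v)^(1/p) (1 - v)⁻¹ = t`. -/
noncomputable def vPlus (p t : ℝ) : ℝ := Function.invFunOn (rootFun p) (Icc 0 (1 / p)) t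

/-- The solution `v ∈ (-∞, 0]` of `(1 - p v)^(1/p) (1 - v)⁻¹ = t`. -/
noncomputable def vMinus (p t : ℝ) : ℝ := Function.invFunOn (rootFun p) (Iic 0) t

noncomputable def sPlus (p Q : ℝ) : ℝ := vPlus p (1 / Q)

noncomputable def sMinus (p Q : ℝ) : ℝ := vMinus p (1 / Q)

/-! The two solutions exist and are unique. -/

theorem rootFun_continuousOn {p : ℝ} (hp : 1 < p) : ContinuousOn (rootFun p) (Iio 1) := by
  unfold rootFun
  apply ContinuousOn.mul
  · apply ContinuousOn.rpow_const (by fun_prop)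
    intro x _
    right; positivity
  · apply ContinuousOn.inv₀ (by fun_prop)
    intro x hx
    have : x < 1 := hx
    linarith

theorem rootFun_eq_exp {p v : ℝ} (hp : 1 < p) (hv : v < 1 / p) :
    0 < 1 - p * v ∧ 0 < 1 - v ∧
      rootFun p v = Real.exp (Real.log (1 - p * v) * (1 / p) - Real.log (1 - v)) := by
  have h0 : 0 < p := by linarith
  have h1 : 0 < 1 - p * v := by
    have := (lt_div_iff₀ h0).1 hv
    linarith
  have h2 : 0 < 1 - v := by
    have : 1 / p < 1 := by rw [div_lt_one h0]; exact hp
    linarith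
  refine ⟨h1, h2, ?_⟩
  rw [Real.exp_sub, Real.exp_log h2, rootFun, Real.rpow_def_of_pos h1,
    div_eq_mul_inv (Real.exp _)]

theorem hasDerivAt_rootLog {p v : ℝ} (hp : 1 < p) (hv : v < 1 / p) :
    HasDerivAt (fun v => Real.log (1 - p * v) * (1 / p) - Real.log (1 - v))
      (-((p - 1) * v / ((1 - p * v) * (1 - v)))) v := by
  obtain ⟨h1, h2, -⟩ := rootFun_eq_exp hp hv
  have h0 : p ≠ 0 := by linarith
  have a : HasDerivAt (fun v : ℝ => 1 - p * v) (-p) v := by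
    simpa using ((hasDerivAt_id v).const_mul p).const_sub 1
  have b : HasDerivAt (fun v : ℝ => 1 - v) (-1) v := by
    simpa using (hasDerivAt_id v).const_sub 1
  refine ((a.log h1.ne').mul_const (1 / p) |>.sub (b.log h2.ne')).congr_deriv ?_
  have h1' := h1.ne'
  have h2' := h2.ne'
  field_simp
  ring

theorem rootFun_strictAntiOn {p : ℝ} (hp : 1 < p) :
    StrictAntiOn (rootFun p) (Icc 0 (1 / p)) := by
  have h0 : 0 < p := by linarith
  have key : StrictAntiOn (fun v => Real.log (1 - p * v) * (1 / p) - Real.log (1 - v))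
      (Ico 0 (1 / p)) := by
    apply strictAntiOn_of_deriv_neg (convex_Ico _ _)
    · intro v hv
      exact (hasDerivAt_rootLog hp hv.2).continuousAt.continuousWithinAt
    · intro v hv
      rw [interior_Ico] at hv
      rw [(hasDerivAt_rootLog hp hv.2).deriv]
      obtain ⟨h1, h2, -⟩ := rootFun_eq_exp hp hv.2
      have h3 := hv.1
      have h4 : 0 < p - 1 := by linarith
      have : 0 < (p - 1) * v / ((1 - p * v) * (1 - v)) := by positivity
      linarith
  intro x hx y hy hxy
  have hx' : x < 1 / p := lt_of_lt_of_le hxy hy.2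
  obtain ⟨-, -, ex⟩ := rootFun_eq_exp hp hx'
  rcases hy.2.lt_or_eq with h | h
  · obtain ⟨-, -, ey⟩ := rootFun_eq_exp hp h
    rw [ex, ey]
    exact Real.exp_lt_exp.2 (key ⟨hx.1, hx'⟩ ⟨hy.1, h⟩ hxy)
  · have : rootFun p y = 0 := by
      rw [h, rootFun, mul_one_div_cancel h0.ne', sub_self, Real.zero_rpow (by positivity),
        zero_mul]
    rw [this, ex]
    exact Real.exp_pos _

theorem rootFun_strictMonoOn {p : ℝ} (hp : 1 < p) : StrictMonoOn (rootFun p) (Iic 0) := by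
  have h0 : 0 < p := by linarith
  have hlt : ∀ v : ℝ, v ≤ 0 → v < 1 / p := fun v hv => lt_of_le_of_lt hv (by positivity)
  have key : StrictMonoOn (fun v => Real.log (1 - p * v) * (1 / p) - Real.log (1 - v))
      (Iic 0) := by
    apply strictMonoOn_of_deriv_pos (convex_Iic _)
    · intro v hv
      exact (hasDerivAt_rootLog hp (hlt v hv)).continuousAt.continuousWithinAt
    · intro v hv
      rw [interior_Iic] at hv
      have hv' : v < 0 := hv
      rw [(hasDerivAt_rootLog hp (hlt v hv'.le)).deriv]
      obtain ⟨h1, h2, -⟩ := rootFun_eq_exp hp (hlt v hv'.le)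
      rw [← neg_div]
      apply div_pos _ (mul_pos h1 h2)
      nlinarith
  intro x hx y hy hxy
  obtain ⟨-, -, ex⟩ := rootFun_eq_exp hp (hlt x hx)
  obtain ⟨-, -, ey⟩ := rootFun_eq_exp hp (hlt y hy)
  rw [ex, ey]
  exact Real.exp_lt_exp.2 (key hx hy hxy)

theorem exists_rootFun_lt {p t : ℝ} (hp : 1 < p) (ht : 0 < t) :
    ∃ v ≤ 0, rootFun p v < t := by
  have h0 : 0 < p := by linarith
  have hexp : 0 < 1 - 1 / p := by
    have : 1 / p < 1 := by rw [div_lt_one h0]; exact hp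
    linarith
  have hlim : Filter.Tendsto (fun y : ℝ => p ^ (1 / p) * y ^ (-(1 - 1 / p))) Filter.atTop
      (nhds (p ^ (1 / p) * 0)) := (tendsto_rpow_neg_atTop hexp).const_mul _
  rw [mul_zero] at hlim
  obtain ⟨y, hy, hy1⟩ := ((hlim.eventually (gt_mem_nhds ht)).and
    (Filter.eventually_ge_atTop (1 : ℝ))).exists
  have hy0 : 0 < y := by linarith
  refine ⟨1 - y, by linarith, lt_of_le_of_lt ?_ hy⟩
  have e : p ^ (1 / p) * y ^ (-(1 - 1 / p)) = (p * y) ^ (1 / p) * y⁻¹ := by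
    rw [Real.mul_rpow h0.le hy0.le, mul_assoc, ← Real.rpow_neg_one y, ← Real.rpow_add hy0]
    congr 2
    ring
  rw [e, rootFun, sub_sub_cancel]
  gcongr
  · nlinarith
  · nlinarith

theorem vPlus_spec {p t : ℝ} (hp : 1 < p) (ht : t ∈ Icc (0 : ℝ) 1) :
    vPlus p t ∈ Icc 0 (1 / p) ∧ rootFun p (vPlus p t) = t ∧
      ∀ v ∈ Icc 0 (1 / p), rootFun p v = t → v = vPlus p t := by
  have h0 : 0 < p := by linarith
  have h1 : 1 / p < 1 := by rw [div_lt_one h0]; exact hp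
  have hex : ∃ v ∈ Icc 0 (1 / p), rootFun p v = t := by
    have := intermediate_value_Icc' (f := rootFun p) (a := 0) (b := 1 / p) (by positivity)
      ((rootFun_continuousOn hp).mono fun x hx => lt_of_le_of_lt hx.2 h1)
    have e1 : rootFun p (1 / p) = 0 := by
      rw [rootFun, mul_one_div_cancel h0.ne', sub_self, Real.zero_rpow (by positivity), zero_mul]
    have e0 : rootFun p 0 = 1 := by simp [rootFun]
    rw [e1, e0] at this
    obtain ⟨v, hv, e⟩ := this ht
    exact ⟨v, hv, e⟩
  refine ⟨Function.invFunOn_mem hex, Function.invFunOn_eq hex, fun v hv e => ?_⟩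
  exact (rootFun_strictAntiOn hp).injOn hv (Function.invFunOn_mem hex)
    (e.trans (Function.invFunOn_eq hex).symm)

theorem vMinus_spec {p t : ℝ} (hp : 1 < p) (ht : t ∈ Ioc (0 : ℝ) 1) :
    vMinus p t ∈ Iic 0 ∧ rootFun p (vMinus p t) = t ∧
      ∀ v ∈ Iic 0, rootFun p v = t → v = vMinus p t := by
  have hex : ∃ v ∈ Iic 0, rootFun p v = t := by
    obtain ⟨v₀, hv₀, hlt⟩ := exists_rootFun_lt hp ht.1
    have := intermediate_value_Icc (f := rootFun p) hv₀
      ((rootFun_continuousOn hp).mono fun x hx => lt_of_le_of_lt hx.2 one_pos)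
    have e0 : rootFun p 0 = 1 := by simp [rootFun]
    rw [e0] at this
    obtain ⟨v, hv, e⟩ := this ⟨hlt.le, ht.2⟩
    exact ⟨v, hv.2, e⟩
  refine ⟨Function.invFunOn_mem hex, Function.invFunOn_eq hex, fun v hv e => ?_⟩
  exact (rootFun_strictMonoOn hp).injOn hv (Function.invFunOn_mem hex)
    (e.trans (Function.invFunOn_eq hex).symm)

/-!
For `m > 0` let `g_m(x) = x ^ p - (p * Q ^ p * m ^ (p - 1) * x - (p - 1) * Q ^ p * m ^ p)` be the
difference between `x ^ p` and the tangent line at `m` to the curve `y = Q ^ p * x ^ p`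
(`tangentGap`). By convexity, a box `R` satisfies `⟨w ^ p⟩ ≤ Q ^ p * ⟨w⟩ ^ p` exactly if
`∫_R g_m(w) ≤ 0` for some `m`, and then `m = ⟨w⟩` will do. The convex function `g_m` vanishes at
`k * m` for `k = 1 - s`, where `s` is `s_p^+(Q)` or `s_p^-(Q)` (`IsContactRatio`); it is
nonpositive between `k * m` and `m` and nonnegative beyond `k * m`.

*Self-improvement.* Let `R` be a box and `α ≥ ⟨w⟩_R`. A rising sun lemma, which uses that
hyperplanes are null sets, gives disjoint boxes in `R` on which `w` has mean `α` and outside whose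
union `E` one has `w ≤ α` up to an arbitrarily small error (`exists_risingSun`). So
`∫_E g_α(w) ≤ 0`. Passing from `E` to the level set `{w > k * α}` with `k = 1 - s_p^+(Q)` only
removes points with `g_α(w) ≥ 0` and adds points with `g_α(w) ≤ 0`. With the error tending to `0`
this gives `∫_{w > k α} g_α(w) ≤ 0` (`LocalRH.setIntegral_level_gt`). Integrating this over the
levels `β = k * α` against `β ^ (q - p - 1)` gives `∫ w ^ q` the coefficient `levelConst`, a
positive multiple of `1 - q * (1 - k)` for `q > p`, up to terms controlled by `∫ w ^ p`. Hence the
bound holds exactly in the range `q < 1 / s_p^+(Q)`. The levels `α ≤ ⟨w⟩_R` with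
`k = 1 - s_p^-(Q)` give the negative powers of `w`, hence the range of Muckenhoupt classes. The
constants depend only on `p`, `Q`, `q`.

*Sharpness.* A power weight `|x| ^ a` has a larger characteristic on the line than on the
half-line, so the extremal distribution is realized by homogenization instead. From a function `W`
with mean `1` on `[0, 1)` a new one is made that equals `u` on two small margins and consists of
many small copies of `l * W` in between, with mean `1` again. If `u` lies strictly between `k` and
`1`, then for small margins the reverse Hölder inequality on all subintervals persists
(`IsPiece.exists_step`), because the gap to one tangent line has nonpositive integral over each
interval that crosses a margin. Iteration and `u → k` bring the moment of order `p` to `Q ^ p` and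
that of the critical order `1 / (1 - k)` to infinity (`IsContactRatio.exists_piece`). Countably
many such functions, one on each unit interval, form the required weight.
-/

/-! ### The tangent gap -/

/-- The difference between `x ^ p` and the tangent line at `m` to the curve `y = Q ^ p * x ^ p`,
the upper boundary of the set of the pairs `(⟨w⟩, ⟨w ^ p⟩)` allowed by `[w]_{RH_p} ≤ Q`. -/
noncomputable def tangentGap (p Q m x : ℝ) : ℝ :=
  x ^ p - p * Q ^ p * m ^ (p - 1) * x + (p - 1) * Q ^ p * m ^ p

theorem tangentGap_mul_mul {p Q l m x : ℝ} (hl : 0 < l) (hm : 0 ≤ m) (hx : 0 ≤ x) :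
    tangentGap p Q (l * m) (l * x) = l ^ p * tangentGap p Q m x := by
  have h : l ^ p = l ^ (p - 1) * l := by
    rw [← Real.rpow_add_one hl.ne']; simp
  rw [tangentGap, tangentGap, Real.mul_rpow hl.le hm, Real.mul_rpow hl.le hx,
    Real.mul_rpow hl.le hm, h]
  ring

theorem tangentGap_self {p Q m : ℝ} (hm : 0 < m) :
    tangentGap p Q m m = (1 - Q ^ p) * m ^ p := by
  have h : m ^ p = m ^ (p - 1) * m := by
    rw [← Real.rpow_add_one hm.ne']; simp
  rw [tangentGap, h]
  ring

/-- A mean value for which some tangent gap is nonpositive satisfies the reverse Hölder inequality: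
the curve `y = Q ^ p * x ^ p` lies above its tangent lines. -/
theorem le_of_tangentGap_nonpos {p Q m A B : ℝ} (hp : 1 < p) (hQ : 0 < Q) (hm : 0 < m)
    (hA : 0 ≤ A) (h : B - p * Q ^ p * m ^ (p - 1) * A + (p - 1) * Q ^ p * m ^ p ≤ 0) :
    B ≤ Q ^ p * A ^ p := by
  have h1 := one_add_mul_self_le_rpow_one_add (s := A / m - 1)
    (by have : 0 ≤ A / m := by positivity
        linarith) hp.le
  have h2 : m ^ p = m ^ (p - 1) * m := by
    rw [← Real.rpow_add_one hm.ne']; simp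
  rw [add_sub_cancel, Real.div_rpow hA hm.le, le_div_iff₀ (by positivity)] at h1
  have h3 : (1 + p * (A / m - 1)) * m ^ p = p * m ^ (p - 1) * A - (p - 1) * m ^ p := by
    rw [h2]; field_simp; ring
  rw [h3] at h1
  have h4 := mul_le_mul_of_nonneg_left h1 (show (0 : ℝ) ≤ Q ^ p by positivity)
  linarith

theorem convexOn_tangentGap {p Q m : ℝ} (hp : 1 < p) :
    ConvexOn ℝ (Ici 0) (tangentGap p Q m) := by
  have h := ((convexOn_rpow hp.le).add
    ((LinearMap.convexOn ((-(p * Q ^ p * m ^ (p - 1))) • (LinearMap.id : ℝ →ₗ[ℝ] ℝ))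
      (convex_Ici (0 : ℝ))))).add_const ((p - 1) * Q ^ p * m ^ p)
  refine h.congr fun x _ => ?_
  simp [tangentGap, sub_eq_add_neg]

/-- The ratio `k = 1 - v` with `(1 - v) ^ p = Q ^ p * (1 - p * v)`: the tangent line at `m` to the
curve `y = Q ^ p * x ^ p` meets the curve `y = x ^ p` at `k * m`. -/
structure IsContactRatio (p Q k : ℝ) : Prop where
  pos : 0 < k
  den_pos : 0 < p * k - p + 1
  eq : k ^ p = Q ^ p * (p * k - p + 1)

namespace IsContactRatio

variable {p Q k : ℝ}

theorem tangentGap_one (h : IsContactRatio p Q k) : tangentGap p Q 1 k = 0 := by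
  simp only [tangentGap, Real.one_rpow, h.eq]
  ring

theorem one_lt_rpow (hp : 1 < p) (hQ : 1 < Q) : 1 < Q ^ p :=
  Real.one_lt_rpow hQ (by linarith)

theorem ne_one (h : IsContactRatio p Q k) (hp : 1 < p) (hQ : 1 < Q) : k ≠ 1 := by
  rintro rfl
  have := h.eq
  have := one_lt_rpow hp hQ
  simp at *
  linarith

/-- Strictly between the contact point and the point of tangency the gap is negative. -/
theorem tangentGap_neg (h : IsContactRatio p Q k) (hp : 1 < p) (hQ : 1 < Q) {t : ℝ}
    (ht : 0 < t) (ht1 : t ≤ 1) : tangentGap p Q 1 (k + t * (1 - k)) < 0 := by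
  have hc := (convexOn_tangentGap (Q := Q) (m := 1) hp).2 (show k ∈ Ici 0 from h.pos.le)
    (mem_Ici.2 (zero_le_one (α := ℝ))) (show 0 ≤ 1 - t by linarith) ht.le (by ring)
  have h1 := tangentGap_self (p := p) (Q := Q) one_pos
  have h2 := one_lt_rpow hp hQ
  simp only [smul_eq_mul, h.tangentGap_one, h1, Real.one_rpow] at hc
  rw [show k + t * (1 - k) = (1 - t) * k + t * 1 by ring]
  have : t * (1 - Q ^ p) < 0 := mul_neg_of_pos_of_neg ht (by linarith)
  nlinarith

theorem tangentGap_nonpos_of_le (h : IsContactRatio p Q k) (hp : 1 < p) (hQ : 1 < Q)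
    (hk : k < 1) {m x : ℝ} (hm : 0 < m) (h1 : k * m ≤ x) (h2 : x ≤ m) :
    tangentGap p Q m x ≤ 0 := by
  have hx : x = m * (k + (x / m - k) / (1 - k) * (1 - k)) := by
    rw [div_mul_cancel₀ _ (by linarith : (1 - k) ≠ 0)]; field_simp; ring
  have hx0 : 0 ≤ x := le_trans (mul_nonneg h.pos.le hm.le) h1
  have e1 : k ≤ x / m := by rwa [le_div_iff₀ hm]
  have e2 : x / m ≤ 1 := by rwa [div_le_one hm]
  set t := (x / m - k) / (1 - k)
  have ht : 0 ≤ t := div_nonneg (by linarith) (by linarith)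
  have ht1 : t ≤ 1 := by rw [div_le_one (by linarith)]; linarith
  have hk0 := h.pos
  have key := tangentGap_mul_mul (p := p) (Q := Q) hm zero_le_one
    (x := k + t * (1 - k)) (by nlinarith)
  rw [mul_one, ← hx] at key
  rw [key]
  refine mul_nonpos_of_nonneg_of_nonpos (by positivity) ?_
  rcases ht.eq_or_lt with h0 | h0
  · rw [← h0, zero_mul, add_zero, h.tangentGap_one]
  · exact (h.tangentGap_neg hp hQ h0 ht1).le

theorem tangentGap_nonpos_of_ge (h : IsContactRatio p Q k) (hp : 1 < p) (hQ : 1 < Q)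
    (hk : 1 < k) {m x : ℝ} (hm : 0 < m) (h1 : x ≤ k * m) (h2 : m ≤ x) :
    tangentGap p Q m x ≤ 0 := by
  have hx : x = m * (k + (k - x / m) / (k - 1) * (1 - k)) := by
    rw [← neg_sub k 1, mul_neg, div_mul_cancel₀ _ (by linarith : (k - 1) ≠ 0)]
    field_simp; ring
  have hx0 : 0 ≤ x := hm.le.trans h2
  have e1 : x / m ≤ k := by rwa [div_le_iff₀ hm]
  have e2 : 1 ≤ x / m := by rwa [one_le_div hm]
  set t := (k - x / m) / (k - 1)
  have ht : 0 ≤ t := div_nonneg (by linarith) (by linarith)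
  have ht1 : t ≤ 1 := by rw [div_le_one (by linarith)]; linarith
  have hk0 := h.pos
  have key := tangentGap_mul_mul (p := p) (Q := Q) hm zero_le_one
    (x := k + t * (1 - k)) (by nlinarith)
  rw [mul_one, ← hx] at key
  rw [key]
  refine mul_nonpos_of_nonneg_of_nonpos (by positivity) ?_
  rcases ht.eq_or_lt with h0 | h0
  · rw [← h0, zero_mul, add_zero, h.tangentGap_one]
  · exact (h.tangentGap_neg hp hQ h0 ht1).le

/-- Beyond the contact point the gap is nonnegative: by convexity, a negative value there and the
negative value at the point of tangency would force a negative value at the contact point. -/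
theorem tangentGap_nonneg_aux (h : IsContactRatio p Q k) (hp : 1 < p) (hQ : 1 < Q)
    {x a b : ℝ} (hx : 0 ≤ x) (ha : 0 < a) (hb : 0 ≤ b) (hab : a + b = 1)
    (e : a * x + b = k) : 0 ≤ tangentGap p Q 1 x := by
  have hc := (convexOn_tangentGap (Q := Q) (m := 1) hp).2 (show x ∈ Ici 0 from hx)
    (mem_Ici.2 (zero_le_one (α := ℝ))) ha.le hb hab
  have h1 := tangentGap_self (p := p) (Q := Q) one_pos
  have h2 := one_lt_rpow hp hQ
  simp only [smul_eq_mul, mul_one, e, h.tangentGap_one, h1, Real.one_rpow] at hc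
  by_contra! hneg
  nlinarith

theorem tangentGap_nonneg_of_le (h : IsContactRatio p Q k) (hp : 1 < p) (hQ : 1 < Q)
    (hk : k < 1) {m x : ℝ} (hm : 0 < m) (hx : 0 ≤ x) (h1 : x ≤ k * m) :
    0 ≤ tangentGap p Q m x := by
  have e1 : x / m ≤ k := by rwa [div_le_iff₀ hm]
  have key := tangentGap_mul_mul (p := p) (Q := Q) hm zero_le_one (x := x / m) (by positivity)
  rw [mul_one, mul_div_cancel₀ _ hm.ne'] at key
  rw [key]
  have hd : 0 < 1 - x / m := by linarith
  refine mul_nonneg (by positivity) (h.tangentGap_nonneg_aux hp hQ (by positivity)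
    (a := (1 - k) / (1 - x / m)) (b := (k - x / m) / (1 - x / m))
    (div_pos (by linarith) hd) (div_nonneg (by linarith) hd.le) ?_ ?_)
  · rw [← add_div, div_eq_one_iff_eq hd.ne']; ring
  · rw [div_mul_eq_mul_div, ← add_div, div_eq_iff hd.ne']; ring

theorem tangentGap_nonneg_of_ge (h : IsContactRatio p Q k) (hp : 1 < p) (hQ : 1 < Q)
    (hk : 1 < k) {m x : ℝ} (hm : 0 < m) (h1 : k * m ≤ x) :
    0 ≤ tangentGap p Q m x := by
  have e1 : k ≤ x / m := by rwa [le_div_iff₀ hm]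
  have hx : 0 ≤ x := le_trans (mul_nonneg h.pos.le hm.le) h1
  have key := tangentGap_mul_mul (p := p) (Q := Q) hm zero_le_one (x := x / m) (by positivity)
  rw [mul_one, mul_div_cancel₀ _ hm.ne'] at key
  rw [key]
  have hd : 0 < x / m - 1 := by linarith
  refine mul_nonneg (by positivity) (h.tangentGap_nonneg_aux hp hQ (by positivity)
    (a := (k - 1) / (x / m - 1)) (b := (x / m - k) / (x / m - 1))
    (div_pos (by linarith) hd) (div_nonneg (by linarith) hd.le) ?_ ?_)
  · rw [← add_div, div_eq_one_iff_eq hd.ne']; ring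
  · rw [div_mul_eq_mul_div, ← add_div, div_eq_iff hd.ne']; ring

end IsContactRatio

theorem isContactRatio_of_rootFun {p Q v : ℝ} (hp : 1 < p) (hQ : 1 < Q) (hv : v ≤ 1 / p)
    (h : rootFun p v = 1 / Q) : IsContactRatio p Q (1 - v) := by
  have h0 : 0 < p := by linarith
  have hQ0 : 0 < Q := by linarith
  have hne : v ≠ 1 / p := by
    rintro rfl
    rw [rootFun, mul_one_div_cancel h0.ne', sub_self, Real.zero_rpow (by positivity),
      zero_mul] at h
    have : 0 < 1 / Q := by positivity
    linarith
  obtain ⟨h1, h2, -⟩ := rootFun_eq_exp hp (lt_of_le_of_ne hv hne)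
  refine ⟨h2, by linarith, ?_⟩
  rw [rootFun, ← div_eq_mul_inv, div_eq_div_iff h2.ne' hQ0.ne', one_mul] at h
  rw [show p * (1 - v) - p + 1 = 1 - p * v by ring, ← h, Real.mul_rpow (by positivity) hQ0.le,
    ← Real.rpow_mul h1.le, one_div_mul_cancel h0.ne', Real.rpow_one, mul_comm]

theorem sPlus_spec {p Q : ℝ} (hp : 1 < p) (hQ : 1 < Q) :
    IsContactRatio p Q (1 - sPlus p Q) ∧ 0 < sPlus p Q := by
  have hQ0 : 0 < Q := by linarith
  obtain ⟨h1, h2, -⟩ := vPlus_spec (t := 1 / Q) hp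
    ⟨by positivity, by rw [div_le_one hQ0]; exact hQ.le⟩
  have h := isContactRatio_of_rootFun hp hQ h1.2 h2
  refine ⟨h, lt_of_le_of_ne h1.1 fun e => h.ne_one hp hQ ?_⟩
  change 0 = vPlus p (1 / Q) at e
  rw [← e, sub_zero]

theorem sMinus_spec {p Q : ℝ} (hp : 1 < p) (hQ : 1 < Q) :
    IsContactRatio p Q (1 - sMinus p Q) ∧ sMinus p Q < 0 := by
  have hQ0 : 0 < Q := by linarith
  obtain ⟨h1, h2, -⟩ := vMinus_spec (t := 1 / Q) hp
    ⟨by positivity, by rw [div_le_one hQ0]; exact hQ.le⟩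
  have h := isContactRatio_of_rootFun hp hQ (le_trans h1 (by positivity)) h2
  refine ⟨h, lt_of_le_of_ne h1 fun e => h.ne_one hp hQ ?_⟩
  change vMinus p (1 / Q) = 0 at e
  rw [e, sub_zero]

/-! ### A rising sun lemma for boxes -/

section RisingSun

variable {n : ℕ}

/-- The half-open box `∏ (a i, b i]`. Half-open boxes are cut into exactly disjoint pieces. -/
def halfBox (a b : Fin n → ℝ) : Set (Fin n → ℝ) := {x | ∀ i, a i < x i ∧ x i ≤ b i}

theorem measurableSet_halfBox (a b : Fin n → ℝ) : MeasurableSet (halfBox a b) := by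
  have : halfBox a b = ⋂ i, {x | a i < x i ∧ x i ≤ b i} := by ext; simp [halfBox]
  rw [this]
  exact MeasurableSet.iInter fun i =>
    (measurableSet_lt measurable_const (measurable_pi_apply i)).inter
      (measurableSet_le (measurable_pi_apply i) measurable_const)

theorem halfBox_subset {a b a' b' : Fin n → ℝ} (ha : a' ≤ a) (hb : b ≤ b') :
    halfBox a b ⊆ halfBox a' b' :=
  fun _ hx i => ⟨(ha i).trans_lt (hx i).1, (hx i).2.trans (hb i)⟩

theorem halfBox_update_right {a b : Fin n → ℝ} {i : Fin n} {t : ℝ} (ht : t ≤ b i) :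
    halfBox a (Function.update b i t) = halfBox a b ∩ {x | x i ≤ t} := by
  ext x
  simp only [halfBox, mem_ofPred_eq, mem_inter_iff]
  constructor
  · intro h
    have hi := (h i).2
    rw [Function.update_self] at hi
    refine ⟨fun j => ⟨(h j).1, ?_⟩, hi⟩
    by_cases hj : j = i
    · subst hj; exact hi.trans ht
    · simpa [hj] using (h j).2
  · rintro ⟨h, hi⟩ j
    refine ⟨(h j).1, ?_⟩
    by_cases hj : j = i
    · subst hj; simpa using hi
    · simpa [hj] using (h j).2

theorem halfBox_update_left {a b : Fin n → ℝ} {i : Fin n} {t : ℝ} (ht : a i ≤ t) :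
    halfBox (Function.update a i t) b = halfBox a b \ {x | x i ≤ t} := by
  ext x
  simp only [halfBox, mem_ofPred_eq, mem_sdiff, not_le]
  constructor
  · intro h
    have hi := (h i).1
    rw [Function.update_self] at hi
    refine ⟨fun j => ⟨?_, (h j).2⟩, hi⟩
    by_cases hj : j = i
    · subst hj; exact ht.trans_lt hi
    · simpa [hj] using (h j).1
  · rintro ⟨h, hi⟩ j
    refine ⟨?_, (h j).2⟩
    by_cases hj : j = i
    · subst hj; simpa using hi
    · simpa [hj] using (h j).1

variable {μ : Measure (Fin n → ℝ)}

theorem continuous_integral_halfBox (hμ : ∀ (i : Fin n) (c : ℝ), μ {x | x i = c} = 0)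
    {f : (Fin n → ℝ) → ℝ} (hf : Integrable f μ) (a b : Fin n → ℝ) (i : Fin n) :
    Continuous fun t => ∫ x in halfBox a b ∩ {x | x i ≤ t}, f x ∂μ := by
  have hm : ∀ t : ℝ, MeasurableSet {x : Fin n → ℝ | x i ≤ t} := fun t =>
    measurableSet_le (measurable_pi_apply i) measurable_const
  have e : (fun t => ∫ x in halfBox a b ∩ {x | x i ≤ t}, f x ∂μ) =
      fun t => ∫ x in halfBox a b, {x | x i ≤ t}.indicator f x ∂μ := by
    ext t
    rw [setIntegral_indicator (hm t)]
  rw [e, continuous_iff_continuousAt]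
  intro t
  refine continuousAt_of_dominated (bound := fun x => ‖f x‖)
    (Filter.Eventually.of_forall fun s => hf.1.restrict.indicator (hm s))
    (Filter.Eventually.of_forall fun s => Filter.Eventually.of_forall fun x =>
      norm_indicator_le_norm_self _ _) hf.norm.restrict ?_
  have h0 : ∀ᵐ x ∂(μ.restrict (halfBox a b)), x i ≠ t := by
    apply ae_restrict_of_ae
    rw [ae_iff]
    simpa using hμ i t
  filter_upwards [h0] with x hx
  rcases lt_or_gt_of_ne hx with h | h
  · refine (continuousAt_const (y := f x)).congr ?_
    filter_upwards [lt_mem_nhds h] with s hs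
    rw [indicator_of_mem]
    exact le_of_lt hs
  · refine (continuousAt_const (y := (0 : ℝ))).congr ?_
    filter_upwards [gt_mem_nhds h] with s hs
    rw [indicator_of_notMem]
    exact not_le.2 hs

/-- `P` has a measurable part `E` over which `h` has nonpositive integral, while `φ` has nonpositive
integral over the rest. -/
def Splits (μ : Measure (Fin n → ℝ)) (h φ : (Fin n → ℝ) → ℝ) (P : Set (Fin n → ℝ)) : Prop :=
  ∃ E ⊆ P, MeasurableSet E ∧ ∫ x in E, h x ∂μ ≤ 0 ∧ ∫ x in P \ E, φ x ∂μ ≤ 0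

theorem Splits.union {h φ : (Fin n → ℝ) → ℝ} (hh : Integrable h μ) (hφ : Integrable φ μ)
    {L U : Set (Fin n → ℝ)} (hU : MeasurableSet U) (hd : Disjoint L U) (h1 : Splits μ h φ L)
    (h2 : Splits μ h φ U) : Splits μ h φ (L ∪ U) := by
  obtain ⟨E, hE, mE, e1, e2⟩ := h1
  obtain ⟨F, hF, mF, f1, f2⟩ := h2
  refine ⟨E ∪ F, union_subset_union hE hF, mE.union mF, ?_, ?_⟩
  · rw [setIntegral_union (hd.mono hE hF) mF hh.integrableOn hh.integrableOn]
    linarith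
  · have : (L ∪ U) \ (E ∪ F) = (L \ E) ∪ (U \ F) := by
      ext x
      have h1 : x ∈ L → x ∉ U := fun hx hx' => disjoint_left.1 hd hx hx'
      have h2 := @hE x
      have h3 := @hF x
      simp only [mem_sdiff, mem_union]
      tauto
    rw [this, setIntegral_union (hd.mono sdiff_subset sdiff_subset) (hU.diff mF)
      hφ.integrableOn hφ.integrableOn]
    linarith

theorem Splits.of_integral_nonpos {h φ : (Fin n → ℝ) → ℝ} {P : Set (Fin n → ℝ)}
    (hP : MeasurableSet P) (h0 : ∫ x in P, h x ∂μ ≤ 0) : Splits μ h φ P :=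
  ⟨P, subset_rfl, hP, h0, by simp⟩

/-- A box with `∫ f ≤ 0` is halved in a given direction; if one half has positive integral, the cut
is moved into the other half until the integral over the enlarged half vanishes. -/
theorem exists_cut (hμ : ∀ (i : Fin n) (c : ℝ), μ {x | x i = c} = 0)
    {f : (Fin n → ℝ) → ℝ} (hf : Integrable f μ) {a b : Fin n → ℝ} (hab : a ≤ b) (i : Fin n)
    (h0 : ∫ x in halfBox a b, f x ∂μ ≤ 0) :
    (∃ t, a i ≤ t ∧ t ≤ b i ∧ t - a i ≤ (b i - a i) / 2 ∧ b i - t ≤ (b i - a i) / 2 ∧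
      ∫ x in halfBox a (Function.update b i t), f x ∂μ ≤ 0 ∧
      ∫ x in halfBox (Function.update a i t) b, f x ∂μ ≤ 0) ∨
    (∃ t, a i ≤ t ∧ t ≤ b i ∧ b i - t ≤ (b i - a i) / 2 ∧
      ∫ x in halfBox a (Function.update b i t), f x ∂μ = 0 ∧
      ∫ x in halfBox (Function.update a i t) b, f x ∂μ ≤ 0) ∨
    (∃ t, a i ≤ t ∧ t ≤ b i ∧ t - a i ≤ (b i - a i) / 2 ∧
      ∫ x in halfBox a (Function.update b i t), f x ∂μ ≤ 0 ∧
      ∫ x in halfBox (Function.update a i t) b, f x ∂μ = 0) := by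
  have hm : ∀ t : ℝ, MeasurableSet {x : Fin n → ℝ | x i ≤ t} := fun t =>
    measurableSet_le (measurable_pi_apply i) measurable_const
  have hc := continuous_integral_halfBox hμ hf a b i
  set F : ℝ → ℝ := fun t => ∫ x in halfBox a b ∩ {x | x i ≤ t}, f x ∂μ
  have hL : ∀ t, t ≤ b i → ∫ x in halfBox a (Function.update b i t), f x ∂μ = F t :=
    fun t ht => by rw [halfBox_update_right ht]
  have hU : ∀ t, a i ≤ t → ∫ x in halfBox (Function.update a i t) b, f x ∂μ =
      ∫ x in halfBox a b, f x ∂μ - F t := fun t ht => by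
    rw [halfBox_update_left ht, eq_sub_iff_add_eq, add_comm]
    exact integral_inter_add_sdiff (hm t) hf.integrableOn
  have hFa : F (a i) = 0 := by
    have : halfBox a b ∩ {x | x i ≤ a i} = ∅ := by
      ext x
      simp only [mem_inter_iff, mem_ofPred_eq, mem_empty_iff_false, iff_false, not_and, not_le]
      exact fun hx => (hx i).1
    simp only [F, this, Measure.restrict_empty, integral_zero_measure]
  have hFb : F (b i) = ∫ x in halfBox a b, f x ∂μ := by
    rw [← hL (b i) le_rfl, Function.update_eq_self]
  have hi := hab i
  set c := (a i + b i) / 2 with hcd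
  by_cases h1 : 0 < F c
  · obtain ⟨t, ht, e⟩ := intermediate_value_Icc' (a := c) (b := b i) (by linarith)
      hc.continuousOn ⟨hFb.trans_le h0, h1.le⟩
    change F t = 0 at e
    have h1 := ht.1
    refine Or.inr (Or.inl ⟨t, by linarith, ht.2, by linarith, ?_, ?_⟩)
    · rw [hL t ht.2, e]
    · rw [hU t (by linarith), e, sub_zero]; exact h0
  by_cases h2 : F c < ∫ x in halfBox a b, f x ∂μ
  · obtain ⟨t, ht, e⟩ := intermediate_value_Icc' (a := a i) (b := c) (by linarith)
      hc.continuousOn ⟨h2.le, h0.trans hFa.ge⟩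
    change F t = _ at e
    have h1 := ht.2
    refine Or.inr (Or.inr ⟨t, ht.1, by linarith, by linarith, ?_, ?_⟩)
    · rw [hL t (by linarith), e]; exact h0
    · rw [hU t ht.1, e, sub_self]
  · refine Or.inl ⟨c, by linarith, by linarith, by linarith, by linarith, ?_, ?_⟩
    · rw [hL c (by linarith)]; linarith
    · rw [hU c (by linarith)]; linarith

variable [IsFiniteMeasure μ]

/-- If `f` is close to a function `g` that varies little on `P`, the empty set is a splitting of
`P`: either `g`, hence `max f 0`, is small on `P`, or `f` is almost nonnegative there, so
`∫ f ≤ 0` bounds the integral of `max f 0`. -/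
theorem splits_of_small {f g h : (Fin n → ℝ) → ℝ} (hf : Integrable f μ) (hg : Integrable g μ)
    {ω : ℝ} (hω : 0 ≤ ω) {P : Set (Fin n → ℝ)} (hP : MeasurableSet P)
    (hosc : ∀ x ∈ P, ∀ y ∈ P, g x ≤ g y + ω) (h0 : ∫ x in P, f x ∂μ ≤ 0) :
    Splits μ h (fun x => max (f x) 0 - 2 * |f x - g x| - ω) P := by
  refine ⟨∅, empty_subset _, MeasurableSet.empty, by simp, ?_⟩
  rw [sdiff_empty]
  have hi1 : Integrable (fun x => max (f x) 0) μ := hf.pos_part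
  have hi2 : Integrable (fun x => |f x - g x|) μ := (hf.sub hg).abs
  have hi : Integrable (fun x => max (f x) 0 - 2 * |f x - g x| - ω) μ :=
    (hi1.sub (hi2.const_mul 2)).sub (integrable_const ω)
  by_cases hx : ∃ x ∈ P, g x ≤ 0
  · obtain ⟨y, hy, hy0⟩ := hx
    apply setIntegral_nonpos hP
    intro x hx
    have := hosc x hx y hy
    have h1 := le_abs_self (f x - g x)
    have h2 := abs_nonneg (f x - g x)
    rcases max_cases (f x) 0 with h | h <;> linarith
  · push Not at hx
    calc ∫ x in P, (max (f x) 0 - 2 * |f x - g x| - ω) ∂μ ≤ ∫ x in P, f x ∂μ := by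
          apply setIntegral_mono_on hi.integrableOn hf.integrableOn hP
          intro x hxP
          have h1 := abs_le.1 (le_refl |f x - g x|)
          have h3 := hx x hxP
          rcases max_cases (f x) 0 with h | h <;> linarith
      _ ≤ 0 := h0

/-- Bisection in the direction of a long edge, with `m` bounding the number of cuts still needed:
the pieces with `∫ f = 0` that arise form the set over which `∫ h ≤ 0`, and the others are cut
further until they are so small that `g` is nearly constant on them. -/
theorem splits_halfBox (hμ : ∀ (i : Fin n) (c : ℝ), μ {x | x i = c} = 0)
    {f g h : (Fin n → ℝ) → ℝ} (hf : Integrable f μ) (hg : Integrable g μ) (hh : Integrable h μ)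
    {a₀ b₀ : Fin n → ℝ}
    (H : ∀ a b, a₀ ≤ a → a ≤ b → b ≤ b₀ → ∫ x in halfBox a b, f x ∂μ = 0 →
      ∫ x in halfBox a b, h x ∂μ ≤ 0)
    {ω δ : ℝ} (hω : 0 ≤ ω) (hδ : 0 ≤ δ) (hosc : ∀ x y, dist x y ≤ δ → g x ≤ g y + ω) (m : ℕ) :
    ∀ a b, a₀ ≤ a → a ≤ b → b ≤ b₀ →
      (∃ k : Fin n → ℕ, ∑ i, k i = m ∧ ∀ i, b i - a i ≤ 2 ^ k i * δ) →
      ∫ x in halfBox a b, f x ∂μ ≤ 0 →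
      Splits μ h (fun x => max (f x) 0 - 2 * |f x - g x| - ω) (halfBox a b) := by
  have hi : Integrable (fun x => max (f x) 0 - 2 * |f x - g x| - ω) μ :=
    (hf.pos_part.sub ((hf.sub hg).abs.const_mul 2)).sub (integrable_const ω)
  induction m with
  | zero =>
    rintro a b - - - ⟨k, hk, hs⟩ h0
    have hk0 : ∀ i, k i = 0 := fun i => (Finset.sum_eq_zero_iff.1 hk) i (Finset.mem_univ i)
    refine splits_of_small hf hg hω (measurableSet_halfBox a b) (fun x hx y hy => ?_) h0
    apply hosc
    rw [dist_pi_le_iff hδ]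
    intro i
    have h1 := hs i
    rw [hk0 i, pow_zero, one_mul] at h1
    have h2 := hx i
    have h3 := hy i
    rw [Real.dist_eq, abs_le]
    constructor <;> linarith
  | succ m ih =>
    rintro a b ha hab hb ⟨k, hk, hs⟩ h0
    obtain ⟨i, hki⟩ : ∃ i, k i ≠ 0 := by
      by_contra! hcon
      simp [hcon] at hk
    obtain ⟨l, hl⟩ := Nat.exists_eq_succ_of_ne_zero hki
    have hsi : (b i - a i) / 2 ≤ 2 ^ l * δ := by
      have := hs i
      rw [hl, pow_succ] at this
      linarith
    have hsum : ∑ j, Function.update k i l j = m := by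
      have h1 := Finset.sum_update_of_mem (Finset.mem_univ i) k l
      have h2 := Finset.sum_eq_add_sum_sdiff_singleton_of_mem (Finset.mem_univ i) k
      omega
    -- after a cut in direction `i`, the pieces to be cut further are half as long in it
    have lower : ∀ t, a i ≤ t → t ≤ b i → t - a i ≤ (b i - a i) / 2 →
        ∫ x in halfBox a (Function.update b i t), f x ∂μ ≤ 0 →
        Splits μ h (fun x => max (f x) 0 - 2 * |f x - g x| - ω)
          (halfBox a (Function.update b i t)) := by
      intro t h1 h2 h3 h4
      refine ih a _ ha ?_ ?_ ⟨_, hsum, fun j => ?_⟩ h4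
      · rw [le_update_iff]; exact ⟨h1, fun j _ => hab j⟩
      · rw [update_le_iff]; exact ⟨h2.trans (hb i), fun j _ => hb j⟩
      · by_cases hj : j = i
        · subst hj; simpa using h3.trans hsi
        · simpa [hj] using hs j
    have upper : ∀ t, a i ≤ t → t ≤ b i → b i - t ≤ (b i - a i) / 2 →
        ∫ x in halfBox (Function.update a i t) b, f x ∂μ ≤ 0 →
        Splits μ h (fun x => max (f x) 0 - 2 * |f x - g x| - ω)
          (halfBox (Function.update a i t) b) := by
      intro t h1 h2 h3 h4
      refine ih _ b ?_ ?_ hb ⟨_, hsum, fun j => ?_⟩ h4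
      · rw [le_update_iff]; exact ⟨(ha i).trans h1, fun j _ => ha j⟩
      · rw [update_le_iff]; exact ⟨h2, fun j _ => hab j⟩
      · by_cases hj : j = i
        · subst hj; simpa using h3.trans hsi
        · simpa [hj] using hs j
    have join : ∀ t, a i ≤ t → t ≤ b i →
        Splits μ h (fun x => max (f x) 0 - 2 * |f x - g x| - ω)
          (halfBox a (Function.update b i t)) →
        Splits μ h (fun x => max (f x) 0 - 2 * |f x - g x| - ω)
          (halfBox (Function.update a i t) b) →
        Splits μ h (fun x => max (f x) 0 - 2 * |f x - g x| - ω) (halfBox a b) := by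
      intro t h1 h2 s1 s2
      have hU := measurableSet_halfBox (Function.update a i t) b
      rw [halfBox_update_right h2] at s1
      rw [halfBox_update_left h1] at s2 hU
      have := Splits.union hh hi hU
        (disjoint_left.2 fun x hx hx' => hx'.2 hx.2) s1 s2
      rwa [inter_union_sdiff] at this
    rcases exists_cut hμ hf hab i h0 with ⟨t, h1, h2, h3, h4, h5, h6⟩ | ⟨t, h1, h2, h3, h4, h5⟩ |
      ⟨t, h1, h2, h3, h4, h5⟩
    · exact join t h1 h2 (lower t h1 h2 h3 h5) (upper t h1 h2 h4 h6)
    · refine join t h1 h2 (Splits.of_integral_nonpos (measurableSet_halfBox _ _)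
        (H _ _ ha ?_ ?_ h4)) (upper t h1 h2 h3 h5)
      · rw [le_update_iff]; exact ⟨h1, fun j _ => hab j⟩
      · rw [update_le_iff]; exact ⟨h2.trans (hb i), fun j _ => hb j⟩
    · refine join t h1 h2 (lower t h1 h2 h3 h4) (Splits.of_integral_nonpos
        (measurableSet_halfBox _ _) (H _ _ ?_ ?_ hb h5))
      · rw [le_update_iff]; exact ⟨(ha i).trans h1, fun j _ => ha j⟩
      · rw [update_le_iff]; exact ⟨h2, fun j _ => hab j⟩

/-- A rising sun lemma for boxes: if `∫ f ≤ 0` over a box, then, up to an arbitrarily small error,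
the set where `f` is positive is covered by disjoint boxes with `∫ f = 0`. The union `E` of
these boxes inherits `∫ h ≤ 0` from them. -/
theorem exists_risingSun (hμ : ∀ (i : Fin n) (c : ℝ), μ {x | x i = c} = 0)
    {f h : (Fin n → ℝ) → ℝ} (hf : Integrable f μ) (hh : Integrable h μ) {a₀ b₀ : Fin n → ℝ}
    (hab : a₀ ≤ b₀)
    (H : ∀ a b, a₀ ≤ a → a ≤ b → b ≤ b₀ → ∫ x in halfBox a b, f x ∂μ = 0 →
      ∫ x in halfBox a b, h x ∂μ ≤ 0)
    (h0 : ∫ x in halfBox a₀ b₀, f x ∂μ ≤ 0) {η : ℝ} (hη : 0 < η) :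
    ∃ E ⊆ halfBox a₀ b₀, MeasurableSet E ∧ ∫ x in E, h x ∂μ ≤ 0 ∧
      ∫ x in halfBox a₀ b₀ \ E, max (f x) 0 ∂μ ≤ η := by
  obtain ⟨g, hgc, hfg, hg, hgi⟩ := hf.exists_hasCompactSupport_integral_sub_le
    (ε := η / 4) (by linarith)
  set ω := η / (2 * (μ.real univ + 1)) with hωd
  have hM : 0 ≤ μ.real univ := measureReal_nonneg
  have hω : 0 < ω := by positivity
  obtain ⟨δ, hδ, hu⟩ := Metric.uniformContinuous_iff.1 (hgc.uniformContinuous_of_continuous hg)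
    ω hω
  have hosc : ∀ x y, dist x y ≤ δ / 2 → g x ≤ g y + ω := by
    intro x y hxy
    have := hu (lt_of_le_of_lt hxy (by linarith))
    rw [Real.dist_eq] at this
    have := (abs_lt.1 this).2
    linarith
  have hk : ∀ i, ∃ k : ℕ, b₀ i - a₀ i ≤ 2 ^ k * (δ / 2) := by
    intro i
    obtain ⟨k, hk⟩ := pow_unbounded_of_one_lt ((b₀ i - a₀ i) / (δ / 2)) (one_lt_two)
    refine ⟨k, ?_⟩
    rw [div_lt_iff₀ (by linarith)] at hk
    exact hk.le
  choose k hk using hk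
  obtain ⟨E, hE, mE, e1, e2⟩ := splits_halfBox hμ hf hgi hh H hω.le (by linarith) hosc _ a₀ b₀
    le_rfl hab le_rfl ⟨k, rfl, hk⟩ h0
  refine ⟨E, hE, mE, e1, ?_⟩
  have i1 : Integrable (fun x => max (f x) 0) μ := hf.pos_part
  have i2 : Integrable (fun x => 2 * |f x - g x|) μ := (hf.sub hgi).abs.const_mul 2
  have i3 : Integrable (fun _ : Fin n → ℝ => ω) μ := integrable_const ω
  have e3 : ∫ x in halfBox a₀ b₀ \ E, (max (f x) 0 - 2 * |f x - g x| - ω) ∂μ =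
      ∫ x in halfBox a₀ b₀ \ E, max (f x) 0 ∂μ -
        ∫ x in halfBox a₀ b₀ \ E, 2 * |f x - g x| ∂μ - ∫ _ in halfBox a₀ b₀ \ E, ω ∂μ := by
    rw [← integral_sub i1.integrableOn i2.integrableOn]
    exact integral_sub (i1.sub i2).integrableOn i3.integrableOn
  rw [e3] at e2
  have b1 : ∫ x in halfBox a₀ b₀ \ E, 2 * |f x - g x| ∂μ ≤ η / 2 := by
    refine (setIntegral_le_integral i2 (Filter.Eventually.of_forall fun x => by
      simp only [Pi.zero_apply]; positivity)).trans ?_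
    rw [integral_const_mul]
    simp only [Real.norm_eq_abs] at hfg
    linarith
  have b2 : ∫ _ in halfBox a₀ b₀ \ E, ω ∂μ ≤ η / 2 := by
    refine (setIntegral_le_integral i3 (Filter.Eventually.of_forall fun x => hω.le)).trans ?_
    rw [integral_const, smul_eq_mul, hωd, mul_div_assoc', div_le_div_iff₀ (by positivity) two_pos]
    nlinarith
  linarith

/-- The form in which the rising sun lemma is used: `∫ h ≤ 0` is transferred from the boxes with
`∫ f = 0` to any set `S` outside which `h` is nonnegative and in which `h` is nonpositive wherever
`f` is. -/
theorem setIntegral_nonpos_of_risingSun (hμ : ∀ (i : Fin n) (c : ℝ), μ {x | x i = c} = 0)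
    {f h : (Fin n → ℝ) → ℝ} (hf : Integrable f μ) (hh : Integrable h μ)
    (hfm : Measurable f) {a₀ b₀ : Fin n → ℝ} (hab : a₀ ≤ b₀)
    (H : ∀ a b, a₀ ≤ a → a ≤ b → b ≤ b₀ → ∫ x in halfBox a b, f x ∂μ = 0 →
      ∫ x in halfBox a b, h x ∂μ ≤ 0)
    (h0 : ∫ x in halfBox a₀ b₀, f x ∂μ ≤ 0) {S : Set (Fin n → ℝ)} (hS : MeasurableSet S)
    (hS1 : ∀ x ∈ S, f x ≤ 0 → h x ≤ 0) (hS2 : ∀ x ∉ S, 0 ≤ h x) :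
    ∫ x in halfBox a₀ b₀ ∩ S, h x ∂μ ≤ 0 := by
  set R := halfBox a₀ b₀
  have hR : MeasurableSet R := measurableSet_halfBox a₀ b₀
  choose E hE mE e1 e2 using fun j : ℕ => exists_risingSun hμ hf hh hab H h0
    (η := 1 / ((j : ℝ) + 1)) (by positivity)
  have mpos : MeasurableSet {x | 0 < f x} := measurableSet_lt measurable_const hfm
  set A : ℕ → Set (Fin n → ℝ) := fun j => (R \ E j) ∩ {x | 0 < f x} with hA
  have mA : ∀ j, MeasurableSet (A j) := fun j => (hR.diff (mE j)).inter mpos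
  have key : ∀ j, ∫ x in R ∩ S, h x ∂μ ≤ ∫ x, (A j).indicator (fun x => |h x|) x ∂μ := by
    intro j
    have i1 := hh.indicator (mE j)
    have i2 := hh.abs.indicator (mA j)
    have : ∫ x, (R ∩ S).indicator h x ∂μ ≤
        ∫ x, ((E j).indicator h x + (A j).indicator (fun x => |h x|) x) ∂μ := by
      apply integral_mono (hh.indicator (hR.inter hS)) (i1.add i2)
      intro x
      simp only [indicator, A, mem_inter_iff]
      have a1 := hS1 x
      have a2 := hS2 x
      have a3 := abs_nonneg (h x)
      have a4 := le_abs_self (h x)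
      have a5 : x ∈ E j → x ∈ R := @hE j x
      by_cases hx1 : x ∈ R <;> by_cases hx2 : x ∈ S <;> by_cases hx3 : x ∈ E j <;>
        by_cases hx4 : 0 < f x <;> simp_all
    rw [integral_add i1 i2, integral_indicator (hR.inter hS), integral_indicator (mE j)] at this
    linarith [e1 j]
  -- `∫ f → 0` over the exceptional sets `A j`, on which `f` is positive
  have hlim1 : Filter.Tendsto (fun j => ∫ x, ‖(A j).indicator f x - 0‖ ∂μ) Filter.atTop
      (nhds 0) := by
    refine squeeze_zero (fun j => integral_nonneg fun x => norm_nonneg _) (fun j => ?_)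
      tendsto_one_div_add_atTop_nhds_zero_nat
    refine le_trans ?_ (e2 j)
    rw [← integral_indicator (hR.diff (mE j))]
    apply integral_mono_of_nonneg (Filter.Eventually.of_forall fun x => norm_nonneg _)
      (hf.pos_part.indicator (hR.diff (mE j)))
    refine Filter.Eventually.of_forall fun x => ?_
    simp only [indicator, A, mem_inter_iff, mem_sdiff]
    by_cases hx1 : x ∈ R ∧ x ∉ E j <;> by_cases hx2 : 0 < f x
    · simp [hx1, hx2, abs_of_pos hx2, hx2.le]
    · simp [hx1, hx2]
    · simp [hx1]
    · simp [hx1]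
  have hmeas : TendstoInMeasure μ (fun j => (A j).indicator f) Filter.atTop (fun _ => 0) := by
    refine tendstoInMeasure_of_tendsto_eLpNorm (p := 1) one_ne_zero
      (fun j => (hf.indicator (mA j)).1) aestronglyMeasurable_const ?_
    have : ∀ j, eLpNorm ((A j).indicator f - fun _ => (0 : ℝ)) 1 μ =
        ENNReal.ofReal (∫ x, ‖(A j).indicator f x - 0‖ ∂μ) := by
      intro j
      rw [eLpNorm_one_eq_lintegral_enorm, ofReal_integral_norm_eq_lintegral_enorm]
      · rfl
      · simpa using hf.indicator (mA j)
    simp only [this]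
    have := (ENNReal.continuous_ofReal.tendsto 0).comp hlim1
    rwa [ENNReal.ofReal_zero] at this
  obtain ⟨ns, hns, hae⟩ := hmeas.exists_seq_tendsto_ae
  have hlim2 : Filter.Tendsto (fun j => ∫ x, (A (ns j)).indicator (fun x => |h x|) x ∂μ)
      Filter.atTop (nhds (∫ _, (0 : ℝ) ∂μ)) := by
    refine tendsto_integral_of_dominated_convergence (fun x => |h x|)
      (fun j => (hh.abs.indicator (mA _)).1) hh.abs
      (fun j => Filter.Eventually.of_forall fun x => ?_)
      ?_
    · simpa using norm_indicator_le_norm_self (fun x => |h x|) x (s := A (ns j))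
    · filter_upwards [hae] with x hx
      by_cases hfx : 0 < f x
      · refine tendsto_const_nhds.congr' ?_
        filter_upwards [hx.eventually (gt_mem_nhds hfx)] with j hj
        rw [indicator_of_notMem]
        intro hmem
        rw [indicator_of_mem hmem] at hj
        exact lt_irrefl _ hj
      · refine tendsto_const_nhds.congr fun j => ?_
        rw [indicator_of_notMem]
        exact fun hmem => hfx hmem.2
  rw [integral_zero] at hlim2
  exact ge_of_tendsto' hlim2 fun j => key _

end RisingSun

/-! ### Integration of the level estimates -/

/-- A primitive in `β` of `β ^ (q - p - 1) * tangentGap p Q (β / k) y`, see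
`IsContactRatio.hasDerivAt_levelPrimitive`. -/
noncomputable def levelPrimitive (p k q y β : ℝ) : ℝ :=
  y ^ p * (β ^ (q - p) / (q - p)) - p * k / (p * k - p + 1) * y * (β ^ (q - 1) / (q - 1)) +
    (p - 1) / (p * k - p + 1) * (β ^ q / q)

/-- The value of `levelPrimitive p k q 1` at `1`. It changes sign exactly at the critical exponent
`q = 1 / (1 - k)`. -/
noncomputable def levelConst (p k q : ℝ) : ℝ :=
  p * (p - 1) * (1 - q * (1 - k)) / ((p * k - p + 1) * (q - p) * (q - 1) * q)

namespace IsContactRatio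

variable {p Q k q : ℝ}

theorem tangentGap_div (h : IsContactRatio p Q k) {β y : ℝ} (hβ : 0 < β) :
    tangentGap p Q (β / k) y =
      y ^ p - p * k / (p * k - p + 1) * y * β ^ (p - 1) + (p - 1) / (p * k - p + 1) * β ^ p := by
  have hk := h.pos
  have hd := h.den_pos.ne'
  have e1 : k ^ p = k ^ (p - 1) * k := by
    rw [← Real.rpow_add_one hk.ne']; simp
  have hkp : 0 < k ^ (p - 1) := by positivity
  have e2 := h.eq
  have hQp : Q ^ p = k ^ (p - 1) * k / (p * k - p + 1) := by
    rw [eq_div_iff hd, ← e2, e1]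
  rw [tangentGap, Real.div_rpow hβ.le hk.le, Real.div_rpow hβ.le hk.le, e1, hQp]
  field_simp

theorem hasDerivAt_levelPrimitive (h : IsContactRatio p Q k) (h0 : q ≠ 0)
    (h1 : q ≠ 1) (hqp : q ≠ p) {β y : ℝ} (hβ : 0 < β) :
    HasDerivAt (levelPrimitive p k q y) (β ^ (q - p - 1) * tangentGap p Q (β / k) y) β := by
  have hq1 : q - 1 ≠ 0 := sub_ne_zero.2 h1
  have hqp' : q - p ≠ 0 := sub_ne_zero.2 hqp
  have d : ∀ e : ℝ, e ≠ 0 → HasDerivAt (fun β : ℝ => β ^ e / e) (β ^ (e - 1)) β := by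
    intro e he
    refine ((Real.hasDerivAt_rpow_const (p := e) (Or.inl hβ.ne')).div_const e).congr_deriv ?_
    field_simp
  refine ((((d _ hqp').const_mul (y ^ p)).sub
    ((d _ hq1).const_mul (p * k / (p * k - p + 1) * y))).add
    ((d _ h0).const_mul ((p - 1) / (p * k - p + 1)))).congr_deriv ?_
  have e1 : β ^ (q - 1 - 1) = β ^ (q - p - 1) * β ^ (p - 1) := by
    rw [← Real.rpow_add hβ]; ring_nf
  have e2 : β ^ (q - 1) = β ^ (q - p - 1) * β ^ p := by
    rw [← Real.rpow_add hβ]; ring_nf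
  rw [h.tangentGap_div hβ, e1, e2]
  ring

theorem continuousOn_level (h : IsContactRatio p Q k) {y s t : ℝ} (hs : 0 < s) :
    ContinuousOn (fun β => β ^ (q - p - 1) * tangentGap p Q (β / k) y) (Icc s t) := by
  have : ContinuousOn (fun β => β ^ (q - p - 1) * (y ^ p - p * k / (p * k - p + 1) * y *
      β ^ (p - 1) + (p - 1) / (p * k - p + 1) * β ^ p)) (Icc s t) := by
    have hne : ∀ e : ℝ, ContinuousOn (fun β : ℝ => β ^ e) (Icc s t) := fun e =>
      continuousOn_id.rpow_const fun x hx => Or.inl (hs.trans_le hx.1).ne'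
    exact (hne _).mul ((continuousOn_const.sub (continuousOn_const.mul (hne _))).add
      (continuousOn_const.mul (hne _)))
  refine this.congr fun β hβ => ?_
  rw [h.tangentGap_div (hs.trans_le hβ.1)]

theorem setIntegral_level (h : IsContactRatio p Q k) (h0 : q ≠ 0)
    (h1 : q ≠ 1) (hqp : q ≠ p) {y s t : ℝ} (hs : 0 < s) (hst : s ≤ t) :
    ∫ β in Ioc s t, β ^ (q - p - 1) * tangentGap p Q (β / k) y =
      levelPrimitive p k q y t - levelPrimitive p k q y s := by
  rw [← intervalIntegral.integral_of_le hst]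
  refine intervalIntegral.integral_eq_sub_of_hasDerivAt (fun β hβ => ?_) ?_
  · rw [uIcc_of_le hst] at hβ
    exact h.hasDerivAt_levelPrimitive h0 h1 hqp (hs.trans_le hβ.1)
  · apply ContinuousOn.intervalIntegrable
    rw [uIcc_of_le hst]
    exact h.continuousOn_level hs

theorem levelPrimitive_scale {M y : ℝ} (hM : 0 < M) (hy : 0 ≤ y) :
    levelPrimitive p k q y M = M ^ q * levelPrimitive p k q (y / M) 1 := by
  have e1 : M ^ q = M ^ p * M ^ (q - p) := by rw [← Real.rpow_add hM]; ring_nf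
  have e2 : M ^ q = M * M ^ (q - 1) := by
    rw [Real.rpow_sub_one hM.ne']; field_simp
  have hMp : 0 < M ^ p := by positivity
  simp only [levelPrimitive, Real.one_rpow]
  rw [Real.div_rpow hy hM.le, mul_add, mul_sub]
  congr 1
  · congr 1
    · rw [e1]; field_simp
    · rw [e2]; field_simp
  · ring

theorem levelPrimitive_one (h : IsContactRatio p Q k) (h0 : q ≠ 0)
    (h1 : q ≠ 1) (hqp : q ≠ p) : levelPrimitive p k q 1 1 = levelConst p k q := by
  have hq1 : q - 1 ≠ 0 := sub_ne_zero.2 h1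
  have hqp' : q - p ≠ 0 := sub_ne_zero.2 hqp
  have hd := h.den_pos.ne'
  simp only [levelPrimitive, levelConst, Real.one_rpow]
  generalize hD : p * k - p + 1 = D at *
  field_simp
  rw [← hD]
  ring

theorem levelPrimitive_slope (h : IsContactRatio p Q k) (h1 : q ≠ 1) (hqp : q ≠ p) :
    1 / (q - p) - k / (p * k - p + 1) / (q - 1) =
      (p - 1) * (1 - q * (1 - k)) / ((p * k - p + 1) * (q - p) * (q - 1)) := by
  have hq1 : q - 1 ≠ 0 := sub_ne_zero.2 h1
  have hqp' : q - p ≠ 0 := sub_ne_zero.2 hqp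
  have hd := h.den_pos.ne'
  generalize hD : p * k - p + 1 = D at *
  field_simp
  rw [← hD]
  ring

theorem levelConst_le (h : IsContactRatio p Q k) (hp : 1 < p) (hq : p < q)
    (hc : q * (1 - k) < 1) {z : ℝ} (hz : 1 ≤ z) :
    levelConst p k q ≤ levelPrimitive p k q z 1 := by
  have hqp : 0 < q - p := by linarith
  have hq1 : 0 < q - 1 := by linarith
  have hd := h.den_pos
  rw [← h.levelPrimitive_one (by linarith) (by linarith) hq.ne']
  have hb := one_add_mul_self_le_rpow_one_add (s := z - 1) (by linarith) hp.le
  rw [add_sub_cancel] at hb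
  have hs : 0 ≤ 1 / (q - p) - k / (p * k - p + 1) / (q - 1) := by
    rw [h.levelPrimitive_slope (by linarith) hq.ne']
    exact div_nonneg (mul_nonneg (by linarith) (by linarith)) (by positivity)
  have e : levelPrimitive p k q z 1 - levelPrimitive p k q 1 1 =
      (z ^ p - (1 + p * (z - 1))) / (q - p) +
        p * (z - 1) * (1 / (q - p) - k / (p * k - p + 1) / (q - 1)) := by
    simp only [levelPrimitive, Real.one_rpow]
    ring
  have : 0 ≤ (z ^ p - (1 + p * (z - 1))) / (q - p) := div_nonneg (by linarith) hqp.le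
  have : 0 ≤ p * (z - 1) * (1 / (q - p) - k / (p * k - p + 1) / (q - 1)) :=
    mul_nonneg (mul_nonneg (by linarith) (by linarith)) hs
  linarith

theorem le_levelConst (h : IsContactRatio p Q k) (hp : 1 < p) (hq : q < 0)
    (hc : q * (1 - k) < 1) {z : ℝ} (hz0 : 0 ≤ z) (hz : z ≤ 1) :
    levelPrimitive p k q z 1 ≤ levelConst p k q := by
  have hqp : q - p < 0 := by linarith
  have hq1 : q - 1 < 0 := by linarith
  have hd := h.den_pos
  rw [← h.levelPrimitive_one (by linarith) (by linarith) (by linarith)]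
  have hb := one_add_mul_self_le_rpow_one_add (s := z - 1) (by linarith) hp.le
  rw [add_sub_cancel] at hb
  have hs : 0 ≤ 1 / (q - p) - k / (p * k - p + 1) / (q - 1) := by
    rw [h.levelPrimitive_slope (by linarith) (by linarith), mul_assoc]
    exact div_nonneg (mul_nonneg (by linarith) (by linarith))
      (mul_nonneg hd.le (mul_pos_of_neg_of_neg hqp hq1).le)
  have e : levelPrimitive p k q z 1 - levelPrimitive p k q 1 1 =
      (z ^ p - (1 + p * (z - 1))) / (q - p) +
        p * (z - 1) * (1 / (q - p) - k / (p * k - p + 1) / (q - 1)) := by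
    simp only [levelPrimitive, Real.one_rpow]
    ring
  have : (z ^ p - (1 + p * (z - 1))) / (q - p) ≤ 0 :=
    div_nonpos_of_nonneg_of_nonpos (by linarith) hqp.le
  have : p * (z - 1) * (1 / (q - p) - k / (p * k - p + 1) / (q - 1)) ≤ 0 :=
    mul_nonpos_of_nonpos_of_nonneg (mul_nonpos_of_nonneg_of_nonpos (by linarith) (by linarith)) hs
  linarith

theorem levelConst_pos (h : IsContactRatio p Q k) (hp : 1 < p) (hq : p < q)
    (hc : q * (1 - k) < 1) : 0 < levelConst p k q := by
  have hqp : 0 < q - p := by linarith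
  have hq1 : 0 < q - 1 := by linarith
  have hq0 : 0 < q := by linarith
  have hp1 : 0 < p - 1 := by linarith
  have hc1 : 0 < 1 - q * (1 - k) := by linarith
  have hd := h.den_pos
  rw [levelConst]
  positivity

theorem levelConst_neg (h : IsContactRatio p Q k) (hp : 1 < p) (hq : q < 0)
    (hc : q * (1 - k) < 1) : levelConst p k q < 0 := by
  have hqp : q - p < 0 := by linarith
  have hq1 : q - 1 < 0 := by linarith
  have hp1 : 0 < p - 1 := by linarith
  have hc1 : 0 < 1 - q * (1 - k) := by linarith
  have hd := h.den_pos
  rw [levelConst]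
  refine div_neg_of_pos_of_neg (by positivity) (mul_neg_of_pos_of_neg ?_ hq)
  rw [mul_assoc]
  exact mul_pos hd (mul_pos_of_neg_of_neg hqp hq1)

/-- Integrating the gap over the levels `β < y` between `β₀` and `N` recovers the power `y ^ q`,
truncated at `N`. -/
theorem rpow_min_le (h : IsContactRatio p Q k) (hp : 1 < p) (hq : p < q)
    (hc : q * (1 - k) < 1) {y β₀ N : ℝ} (hy : 0 < y) (hβ : 0 < β₀) (hN : β₀ ≤ N) :
    levelConst p k q * min y N ^ q ≤
      (∫ β in Ioc β₀ N, {β | β < y}.indicator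
        (fun β => β ^ (q - p - 1) * tangentGap p Q (β / k) y) β) +
      (y ^ p * (β₀ ^ (q - p) / (q - p)) +
        ((p - 1) / (p * k - p + 1) / q + levelConst p k q) * β₀ ^ q) := by
  have hc0 := h.levelConst_pos hp hq hc
  have hqp : 0 < q - p := by linarith
  have hq0 : 0 < q := by linarith
  have hp1 : 0 < p - 1 := by linarith
  have hd := h.den_pos
  have hk := h.pos
  have n1 : 0 ≤ y ^ p * (β₀ ^ (q - p) / (q - p)) := by positivity
  have n2 : 0 ≤ (p - 1) / (p * k - p + 1) / q * β₀ ^ q := by positivity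
  have n3 : 0 ≤ levelConst p k q * β₀ ^ q := by positivity
  rw [setIntegral_indicator (show MeasurableSet {β : ℝ | β < y} from measurableSet_Iio)]
  rcases le_or_gt y β₀ with hy1 | hy1
  · have e : Ioc β₀ N ∩ {β | β < y} = ∅ := by
      ext β
      simp only [mem_inter_iff, mem_Ioc, mem_ofPred_eq, mem_empty_iff_false, iff_false]
      rintro ⟨⟨h1, -⟩, h2⟩
      linarith
    rw [e, Measure.restrict_empty, integral_zero_measure, zero_add]
    have : levelConst p k q * min y N ^ q ≤ levelConst p k q * β₀ ^ q := by
      gcongr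
      · exact le_min hy.le (hβ.le.trans hN)
      · exact (min_le_left _ _).trans hy1
    linarith
  · have hM : 0 < min y N := lt_min hy (hβ.trans_le hN)
    have e : (Ioc β₀ N ∩ {β | β < y} : Set ℝ) =ᵐ[volume] Ioc β₀ (min y N) := by
      have : Ioc β₀ N ∩ {β | β ≤ y} = Ioc β₀ (min y N) := by
        ext β
        simp only [mem_inter_iff, mem_Ioc, mem_ofPred_eq, le_min_iff]
        tauto
      rw [← this]
      exact (ae_eq_refl _).inter Iio_ae_eq_Iic
    rw [setIntegral_congr_set e, h.setIntegral_level hq0.ne' (by linarith) hq.ne' hβ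
      (le_min hy1.le hN), levelPrimitive_scale hM hy.le]
    have h1 := h.levelConst_le hp hq hc (z := y / min y N)
      (by rw [one_le_div hM]; exact min_le_left _ _)
    have h2 := mul_le_mul_of_nonneg_left h1 (show 0 ≤ min y N ^ q by positivity)
    have h3 : levelPrimitive p k q y β₀ ≤ y ^ p * (β₀ ^ (q - p) / (q - p)) +
        (p - 1) / (p * k - p + 1) / q * β₀ ^ q := by
      have : 0 ≤ p * k / (p * k - p + 1) * y * (β₀ ^ (q - 1) / (q - 1)) := by
        have : 0 < q - 1 := by linarith
        positivity
      have e2 : (p - 1) / (p * k - p + 1) * (β₀ ^ q / q) =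
        (p - 1) / (p * k - p + 1) / q * β₀ ^ q := by ring
      rw [levelPrimitive, e2]
      linarith
    linarith

/-- The counterpart of `rpow_min_le` for negative powers and the levels `β > y` below `β₀`. -/
theorem rpow_max_le (h : IsContactRatio p Q k) (hp : 1 < p) (hq : q < 0)
    (hc : q * (1 - k) < 1) {y β₀ δ : ℝ} (hy : 0 < y) (hδ : 0 < δ) (hδβ : δ ≤ β₀) :
    -levelConst p k q * max y δ ^ q ≤
      (∫ β in Ioc δ β₀, {β | y < β}.indicator
        (fun β => β ^ (q - p - 1) * tangentGap p Q (β / k) y) β) +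
      (1 / (p - q) + (p - 1) / (p * k - p + 1) / (-q) - levelConst p k q) * β₀ ^ q := by
  have hc0 := h.levelConst_neg hp hq hc
  have hβ : 0 < β₀ := hδ.trans_le hδβ
  have hqp : 0 < p - q := by linarith
  have hq0 : 0 < -q := by linarith
  have hp1 : 0 < p - 1 := by linarith
  have hd := h.den_pos
  have hk := h.pos
  have n1 : 0 ≤ 1 / (p - q) * β₀ ^ q := by positivity
  have n2 : 0 ≤ (p - 1) / (p * k - p + 1) / (-q) * β₀ ^ q := by positivity
  have n3 : 0 ≤ -levelConst p k q * β₀ ^ q := mul_nonneg (by linarith) (by positivity)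
  have hM : 0 < max y δ := lt_max_of_lt_left hy
  rw [setIntegral_indicator (show MeasurableSet {β : ℝ | y < β} from measurableSet_Ioi)]
  rcases le_or_gt β₀ y with hy1 | hy1
  · have e : Ioc δ β₀ ∩ {β | y < β} = ∅ := by
      ext β
      simp only [mem_inter_iff, mem_Ioc, mem_ofPred_eq, mem_empty_iff_false, iff_false]
      rintro ⟨⟨-, h1⟩, h2⟩
      linarith
    rw [e, Measure.restrict_empty, integral_zero_measure, zero_add]
    have : -levelConst p k q * max y δ ^ q ≤ -levelConst p k q * β₀ ^ q :=
      mul_le_mul_of_nonneg_left (Real.rpow_le_rpow_of_nonpos hβ (hy1.trans (le_max_left _ _)) hq.le)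
        (by linarith)
    linarith
  · have e : Ioc δ β₀ ∩ {β | y < β} = Ioc (max y δ) β₀ := by
      ext β
      simp only [mem_inter_iff, mem_Ioc, mem_ofPred_eq, max_lt_iff]
      tauto
    rw [e, h.setIntegral_level hq.ne (by linarith) (by linarith) hM
      (max_le hy1.le hδβ), levelPrimitive_scale hM hy.le]
    have h1 := h.le_levelConst hp hq hc (z := y / max y δ) (by positivity)
      (by rw [div_le_one hM]; exact le_max_left _ _)
    have h2 := mul_le_mul_of_nonneg_left h1 (show 0 ≤ max y δ ^ q by positivity)
    have h3 : -(1 / (p - q) * β₀ ^ q) - (p - 1) / (p * k - p + 1) / (-q) * β₀ ^ q ≤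
        levelPrimitive p k q y β₀ := by
      have a1 : 0 ≤ p * k / (p * k - p + 1) * y * (β₀ ^ (q - 1) / (1 - q)) := by
        have : 0 < 1 - q := by linarith
        positivity
      have a2 : y ^ p * (β₀ ^ (q - p) / (p - q)) ≤ 1 / (p - q) * β₀ ^ q := by
        have b1 : y ^ p ≤ β₀ ^ p := Real.rpow_le_rpow hy.le hy1.le (by linarith)
        have b2 : β₀ ^ q = β₀ ^ p * β₀ ^ (q - p) := by rw [← Real.rpow_add hβ]; ring_nf
        rw [b2]
        have := mul_le_mul_of_nonneg_right b1 (show 0 ≤ β₀ ^ (q - p) / (p - q) by positivity)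
        refine this.trans (le_of_eq ?_)
        ring
      have e1 : β₀ ^ (q - p) / (q - p) = - (β₀ ^ (q - p) / (p - q)) := by
        rw [← neg_sub p q, div_neg]
      have e2 : β₀ ^ (q - 1) / (q - 1) = - (β₀ ^ (q - 1) / (1 - q)) := by
        rw [← neg_sub 1 q, div_neg]
      have e3 : (p - 1) / (p * k - p + 1) / (-q) * β₀ ^ q =
          -((p - 1) / (p * k - p + 1) * (β₀ ^ q / q)) := by
        rw [div_neg]; ring
      rw [levelPrimitive, e1, e2, e3]
      linarith
    linarith

end IsContactRatio

/-! ### Self-improvement on a box -/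

/-- Passage to the limit in the truncation. -/
theorem lintegral_rpow_le_of_truncation {n : ℕ} {ν : Measure (Fin n → ℝ)} {q : ℝ}
    {w : (Fin n → ℝ) → ℝ} (T : ℕ → ℝ → ℝ)
    (hT : ∀ j, Measurable (T j)) (hlim : ∀ y, 0 < y → ∀ᶠ j in Filter.atTop, T j y = y ^ q)
    (hw : Measurable w) (hpos : ∀ x, 0 < w x) (hnn : ∀ j x, 0 ≤ T j (w x))
    (hi : ∀ j, Integrable (fun x => T j (w x)) ν)
    {B : ℝ} (hB : ∀ᶠ j in Filter.atTop, ∫ x, T j (w x) ∂ν ≤ B) :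
    ∫⁻ x, ENNReal.ofReal (w x ^ q) ∂ν ≤ ENNReal.ofReal B := by
  have hF := lintegral_liminf_le (μ := ν) (f := fun j x => ENNReal.ofReal (T j (w x)))
    (u := Filter.atTop) fun j => ((hT j).comp hw).ennreal_ofReal
  have e : ∀ x, Filter.liminf (fun j => ENNReal.ofReal (T j (w x))) Filter.atTop =
      ENNReal.ofReal (w x ^ q) := by
    intro x
    apply Filter.Tendsto.liminf_eq
    refine tendsto_const_nhds.congr' ?_
    filter_upwards [hlim (w x) (hpos x)] with j hj
    rw [hj]
  simp only [e] at hF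
  refine hF.trans (Filter.liminf_le_of_frequently_le' ?_)
  refine Filter.Eventually.frequently ?_
  filter_upwards [hB] with j hj
  rw [← ofReal_integral_eq_lintegral_ofReal (hi j) (Filter.Eventually.of_forall (hnn j))]
  exact ENNReal.ofReal_le_ofReal hj

/-- The reverse Hölder condition on all subboxes of a half-open box that carries the finite
measure `ν`. -/
structure LocalRH {n : ℕ} (ν : Measure (Fin n → ℝ)) (p Q : ℝ) (w : (Fin n → ℝ) → ℝ)
    (a₀ b₀ : Fin n → ℝ) : Prop where
  null : ∀ (i : Fin n) (c : ℝ), ν {x | x i = c} = 0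
  le : a₀ ≤ b₀
  ae_mem : ∀ᵐ x ∂ν, x ∈ halfBox a₀ b₀
  measurable : Measurable w
  pos : ∀ x, 0 < w x
  integrable : Integrable w ν
  integrable_rpow : Integrable (fun x => w x ^ p) ν
  rh : ∀ a b α, a₀ ≤ a → a ≤ b → b ≤ b₀ → 0 < α →
    ∫ x in halfBox a b, w x ∂ν = α * ν.real (halfBox a b) →
    ∫ x in halfBox a b, w x ^ p ∂ν ≤ Q ^ p * α ^ p * ν.real (halfBox a b)

namespace LocalRH

variable {n : ℕ} {ν : Measure (Fin n → ℝ)} {p Q k q : ℝ} {w : (Fin n → ℝ) → ℝ}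
  {a₀ b₀ : Fin n → ℝ}

theorem halfBox_ae_eq_univ (H : LocalRH ν p Q w a₀ b₀) : halfBox a₀ b₀ =ᵐ[ν] univ :=
  Filter.eventuallyEq_univ.2 H.ae_mem

theorem integral_rpow_le (H : LocalRH ν p Q w a₀ b₀) {m : ℝ} (hm : 0 < m)
    (hwm : ∫ x, w x ∂ν = m * ν.real univ) :
    ∫ x, w x ^ p ∂ν ≤ Q ^ p * m ^ p * ν.real univ := by
  have hfull := H.halfBox_ae_eq_univ
  have := H.rh a₀ b₀ m le_rfl H.le le_rfl hm
  rw [setIntegral_congr_set hfull, setIntegral_congr_set hfull, setIntegral_univ,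
    setIntegral_univ, measureReal_congr hfull] at this
  exact this hwm

variable [IsFiniteMeasure ν]

theorem integrable_tangentGap (H : LocalRH ν p Q w a₀ b₀) (m : ℝ) :
    Integrable (fun x => tangentGap p Q m (w x)) ν :=
  (H.integrable_rpow.sub (H.integrable.const_mul _)).add (integrable_const _)

theorem setIntegral_tangentGap_nonpos (H : LocalRH ν p Q w a₀ b₀) {a b : Fin n → ℝ}
    (ha : a₀ ≤ a) (hab : a ≤ b) (hb : b ≤ b₀) {m : ℝ} (hm : 0 < m)
    (h : ∫ x in halfBox a b, w x ∂ν = m * ν.real (halfBox a b)) :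
    ∫ x in halfBox a b, tangentGap p Q m (w x) ∂ν ≤ 0 := by
  have i1 := H.integrable_rpow.integrableOn (s := halfBox a b)
  have i2 := (H.integrable.const_mul (p * Q ^ p * m ^ (p - 1))).integrableOn (s := halfBox a b)
  have i3 : IntegrableOn (fun _ => (p - 1) * Q ^ p * m ^ p) (halfBox a b) ν :=
    (integrable_const _).integrableOn
  have e : ∫ x in halfBox a b, tangentGap p Q m (w x) ∂ν =
      ∫ x in halfBox a b, w x ^ p ∂ν - p * Q ^ p * m ^ (p - 1) * ∫ x in halfBox a b, w x ∂ν +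
        ν.real (halfBox a b) * ((p - 1) * Q ^ p * m ^ p) := by
    rw [← integral_const_mul, ← integral_sub i1 i2, ← smul_eq_mul (ν.real (halfBox a b)),
      ← setIntegral_const]
    exact integral_add (i1.sub i2) i3
  have h1 := H.rh a b m ha hab hb hm h
  have e2 : m ^ p = m ^ (p - 1) * m := by
    rw [← Real.rpow_add_one hm.ne']; simp
  rw [e, h]
  rw [e2] at h1 ⊢
  linarith

/-- The set that the rising sun lemma provides at the level `β / k` may be replaced by `{w > β}`:
the tangent gap is nonpositive for `β < w ≤ β / k` and nonnegative for `w ≤ β`. -/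
theorem setIntegral_level_gt (H : LocalRH ν p Q w a₀ b₀) (h : IsContactRatio p Q k) (hp : 1 < p)
    (hQ : 1 < Q) (hk : k < 1) {m β : ℝ} (hm : 0 < m) (hwm : ∫ x, w x ∂ν = m * ν.real univ)
    (hβ : k * m ≤ β) : ∫ x in {x | β < w x}, tangentGap p Q (β / k) (w x) ∂ν ≤ 0 := by
  have hk0 := h.pos
  have hmβ : m ≤ β / k := by rw [le_div_iff₀ hk0]; linarith
  have hα : 0 < β / k := hm.trans_le hmβ
  have hkα : k * (β / k) = β := mul_div_cancel₀ _ hk0.ne'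
  have mS : MeasurableSet {x | β < w x} := measurableSet_lt measurable_const H.measurable
  have hfull := H.halfBox_ae_eq_univ
  have hfi : Integrable (fun x => w x - β / k) ν := H.integrable.sub (integrable_const _)
  have key := setIntegral_nonpos_of_risingSun H.null (f := fun x => w x - β / k)
    (h := fun x => tangentGap p Q (β / k) (w x)) hfi
    (H.integrable_tangentGap _) (H.measurable.sub_const _) H.le ?_ ?_ mS ?_ ?_
  · rwa [setIntegral_congr_set (inter_ae_eq_right_of_ae_eq_univ hfull)] at key
  · intro a b ha hab hb h0
    refine H.setIntegral_tangentGap_nonpos ha hab hb hα ?_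
    rw [integral_sub H.integrable.integrableOn (integrable_const _).integrableOn,
      setIntegral_const, smul_eq_mul] at h0
    linarith
  · rw [setIntegral_congr_set hfull, setIntegral_univ, integral_sub H.integrable
      (integrable_const _), integral_const, smul_eq_mul, hwm]
    have := mul_le_mul_of_nonneg_left hmβ (measureReal_nonneg (μ := ν) (s := univ))
    linarith
  · intro x hx hx2
    exact h.tangentGap_nonpos_of_le hp hQ hk hα (by rw [hkα]; exact le_of_lt hx) (by linarith)
  · intro x hx
    exact h.tangentGap_nonneg_of_le hp hQ hk hα (H.pos x).le (by rw [hkα]; exact not_lt.1 hx)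

/-- The counterpart of `setIntegral_level_gt` for the contact ratio above `1`, which controls small
values of `w`. -/
theorem setIntegral_level_lt (H : LocalRH ν p Q w a₀ b₀) (h : IsContactRatio p Q k) (hp : 1 < p)
    (hQ : 1 < Q) (hk : 1 < k) {m β : ℝ} (hβ0 : 0 < β) (hwm : ∫ x, w x ∂ν = m * ν.real univ)
    (hβ : β ≤ k * m) : ∫ x in {x | w x < β}, tangentGap p Q (β / k) (w x) ∂ν ≤ 0 := by
  have hk0 := h.pos
  have hmβ : β / k ≤ m := by rw [div_le_iff₀ hk0]; linarith
  have hα : 0 < β / k := by positivity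
  have hkα : k * (β / k) = β := mul_div_cancel₀ _ hk0.ne'
  have mS : MeasurableSet {x | w x < β} := measurableSet_lt H.measurable measurable_const
  have hfull := H.halfBox_ae_eq_univ
  have hfi : Integrable (fun x => β / k - w x) ν := (integrable_const _).sub H.integrable
  have key := setIntegral_nonpos_of_risingSun H.null (f := fun x => β / k - w x)
    (h := fun x => tangentGap p Q (β / k) (w x)) hfi
    (H.integrable_tangentGap _) (H.measurable.const_sub _) H.le ?_ ?_ mS ?_ ?_
  · rwa [setIntegral_congr_set (inter_ae_eq_right_of_ae_eq_univ hfull)] at key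
  · intro a b ha hab hb h0
    refine H.setIntegral_tangentGap_nonpos ha hab hb hα ?_
    rw [integral_sub (integrable_const _).integrableOn H.integrable.integrableOn,
      setIntegral_const, smul_eq_mul] at h0
    linarith
  · rw [setIntegral_congr_set hfull, setIntegral_univ, integral_sub (integrable_const _)
      H.integrable, integral_const, smul_eq_mul, hwm]
    have := mul_le_mul_of_nonneg_left hmβ (measureReal_nonneg (μ := ν) (s := univ))
    linarith
  · intro x hx hx2
    exact h.tangentGap_nonpos_of_ge hp hQ hk hα (by rw [hkα]; exact le_of_lt hx) (by linarith)
  · intro x hx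
    exact h.tangentGap_nonneg_of_ge hp hQ hk hα (by rw [hkα]; exact not_lt.1 hx)

theorem integrable_level (H : LocalRH ν p Q w a₀ b₀) (h : IsContactRatio p Q k) {s t : ℝ}
    (hs : 0 < s) {D : Set ((Fin n → ℝ) × ℝ)} (hD : MeasurableSet D) :
    Integrable (D.indicator fun z => z.2 ^ (q - p - 1) * tangentGap p Q (z.2 / k) (w z.1))
      (ν.prod (volume.restrict (Ioc s t))) := by
  refine Integrable.indicator ?_ hD
  have hne : ∀ e : ℝ, ContinuousOn (fun β : ℝ => β ^ e) (Icc s t) := fun e =>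
    continuousOn_id.rpow_const fun x hx => Or.inl (hs.trans_le hx.1).ne'
  have hi : ∀ e : ℝ, Integrable (fun β : ℝ => β ^ (q - p - 1) * β ^ e)
      (volume.restrict (Ioc s t)) := fun e =>
    (((hne (q - p - 1)).mul (hne e)).integrableOn_Icc).mono_set Ioc_subset_Icc_self
  have i1 := H.integrable_rpow.mul_prod (hi 0)
  have i2 := (H.integrable.const_mul (-(p * k / (p * k - p + 1)))).mul_prod (hi (p - 1))
  have i3 := (integrable_const (μ := ν) ((p - 1) / (p * k - p + 1))).mul_prod (hi p)
  refine ((i1.add i2).add i3).congr ?_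
  have hmem : ∀ᵐ z ∂(ν.prod (volume.restrict (Ioc s t))), z.2 ∈ Ioc s t :=
    Measure.quasiMeasurePreserving_snd.ae (ae_restrict_mem measurableSet_Ioc)
  filter_upwards [hmem] with z hz
  simp only [Pi.add_apply]
  rw [h.tangentGap_div (hs.trans hz.1), Real.rpow_zero]
  ring

/-- Fubini for the level estimates: they may be integrated against `β ^ (q - p - 1)`. -/
theorem integral_level_nonpos (H : LocalRH ν p Q w a₀ b₀) (h : IsContactRatio p Q k) {s t : ℝ}
    (hs : 0 < s) {D : Set ((Fin n → ℝ) × ℝ)} (hD : MeasurableSet D)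
    (hlev : ∀ β, s < β → β ≤ t →
      ∫ x in {x | (x, β) ∈ D}, tangentGap p Q (β / k) (w x) ∂ν ≤ 0) :
    ∫ x, (∫ β in Ioc s t, {β | (x, β) ∈ D}.indicator
      (fun β => β ^ (q - p - 1) * tangentGap p Q (β / k) (w x)) β) ∂ν ≤ 0 := by
  have hI := H.integrable_level (q := q) (t := t) h hs hD
  have e := integral_integral_swap (f := fun x β =>
    {β | (x, β) ∈ D}.indicator (fun β => β ^ (q - p - 1) * tangentGap p Q (β / k) (w x)) β) hI
  rw [e]
  apply setIntegral_nonpos measurableSet_Ioc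
  intro β hβ
  have mD : MeasurableSet {x | (x, β) ∈ D} := measurable_prodMk_right hD
  have : (fun x => {β | (x, β) ∈ D}.indicator
      (fun β => β ^ (q - p - 1) * tangentGap p Q (β / k) (w x)) β) =
      {x | (x, β) ∈ D}.indicator (fun x => β ^ (q - p - 1) * tangentGap p Q (β / k) (w x)) := by
    ext x
    simp only [indicator, mem_ofPred_eq]
  rw [this, integral_indicator mD, integral_const_mul]
  exact mul_nonpos_of_nonneg_of_nonpos (Real.rpow_nonneg (hs.trans hβ.1).le _)
    (hlev β hβ.1 hβ.2)

theorem integral_inner (H : LocalRH ν p Q w a₀ b₀) (h : IsContactRatio p Q k) {s t : ℝ}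
    (hs : 0 < s) {D : Set ((Fin n → ℝ) × ℝ)} (hD : MeasurableSet D) :
    Integrable (fun x => ∫ β in Ioc s t, {β | (x, β) ∈ D}.indicator
      (fun β => β ^ (q - p - 1) * tangentGap p Q (β / k) (w x)) β) ν :=
  (H.integrable_level (q := q) (t := t) h hs hD).integral_prod_left

theorem integral_min_rpow_le (H : LocalRH ν p Q w a₀ b₀) (h : IsContactRatio p Q k) (hp : 1 < p)
    (hQ : 1 < Q) (hk : k < 1) (hq : p < q) (hc : q * (1 - k) < 1) {m N : ℝ} (hm : 0 < m)
    (hwm : ∫ x, w x ∂ν = m * ν.real univ) (hN : k * m ≤ N) :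
    levelConst p k q * ∫ x, min (w x) N ^ q ∂ν ≤
      (Q ^ p * (k ^ (q - p) / (q - p)) +
        ((p - 1) / (p * k - p + 1) / q + levelConst p k q) * k ^ q) * (m ^ q * ν.real univ) := by
  have hk0 := h.pos
  have hβ : 0 < k * m := by positivity
  have hD : MeasurableSet {z : (Fin n → ℝ) × ℝ | z.2 < w z.1} :=
    measurableSet_lt measurable_snd (H.measurable.comp measurable_fst)
  have h1 := H.integral_level_nonpos (q := q) (s := k * m) (t := N) h hβ hD fun β hβ1 _ =>
    H.setIntegral_level_gt h hp hQ hk hm hwm hβ1.le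
  have i1 := H.integral_inner (q := q) (s := k * m) (t := N) h hβ hD
  have i2 : Integrable (fun x => w x ^ p * ((k * m) ^ (q - p) / (q - p)) +
        ((p - 1) / (p * k - p + 1) / q + levelConst p k q) * (k * m) ^ q) ν :=
    (H.integrable_rpow.mul_const _).add (integrable_const _)
  have hrh := H.integral_rpow_le hm hwm
  have step : ∫ x, levelConst p k q * min (w x) N ^ q ∂ν ≤
      ∫ x, ((∫ β in Ioc (k * m) N, {β | β < w x}.indicator
        (fun β => β ^ (q - p - 1) * tangentGap p Q (β / k) (w x)) β) +
      (w x ^ p * ((k * m) ^ (q - p) / (q - p)) +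
        ((p - 1) / (p * k - p + 1) / q + levelConst p k q) * (k * m) ^ q)) ∂ν := by
    refine integral_mono_of_nonneg (Filter.Eventually.of_forall fun x => ?_) (i1.add i2)
      (Filter.Eventually.of_forall fun x => h.rpow_min_le hp hq hc (H.pos x) hβ hN)
    exact mul_nonneg (h.levelConst_pos hp hq hc).le
      (Real.rpow_nonneg (le_min (H.pos x).le (hβ.le.trans hN)) _)
  have e : ∫ x, ((∫ β in Ioc (k * m) N, {β | β < w x}.indicator
        (fun β => β ^ (q - p - 1) * tangentGap p Q (β / k) (w x)) β) +
      (w x ^ p * ((k * m) ^ (q - p) / (q - p)) +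
        ((p - 1) / (p * k - p + 1) / q + levelConst p k q) * (k * m) ^ q)) ∂ν =
      (∫ x, (∫ β in Ioc (k * m) N, {β | β < w x}.indicator
        (fun β => β ^ (q - p - 1) * tangentGap p Q (β / k) (w x)) β) ∂ν) +
      ((∫ x, w x ^ p ∂ν) * ((k * m) ^ (q - p) / (q - p)) +
        ν.real univ * (((p - 1) / (p * k - p + 1) / q + levelConst p k q) * (k * m) ^ q)) := by
    rw [← smul_eq_mul (ν.real univ), ← integral_const, ← integral_mul_const,
      ← integral_add (H.integrable_rpow.mul_const _) (integrable_const _)]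
    exact integral_add i1 i2
  rw [e, integral_const_mul] at step
  have h2 : (∫ x, w x ^ p ∂ν) * ((k * m) ^ (q - p) / (q - p)) ≤
      Q ^ p * m ^ p * ν.real univ * ((k * m) ^ (q - p) / (q - p)) := by
    have : 0 < q - p := by linarith
    gcongr
  have e3 : m ^ q = m ^ p * m ^ (q - p) := by rw [← Real.rpow_add hm]; ring_nf
  rw [Real.mul_rpow hk0.le hm.le, Real.mul_rpow hk0.le hm.le] at *
  refine (step.trans (add_le_add h1 (add_le_add_left h2 _))).trans (le_of_eq ?_)
  rw [e3]
  ring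

theorem integral_max_rpow_le (H : LocalRH ν p Q w a₀ b₀) (h : IsContactRatio p Q k) (hp : 1 < p)
    (hQ : 1 < Q) (hk : 1 < k) (hq : q < 0) (hc : q * (1 - k) < 1) {m δ : ℝ} (hm : 0 < m)
    (hwm : ∫ x, w x ∂ν = m * ν.real univ) (hδ : 0 < δ) (hδm : δ ≤ k * m) :
    -levelConst p k q * ∫ x, max (w x) δ ^ q ∂ν ≤
      ((1 / (p - q) + (p - 1) / (p * k - p + 1) / (-q) - levelConst p k q) * k ^ q) *
        (m ^ q * ν.real univ) := by
  have hk0 := h.pos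
  have hD : MeasurableSet {z : (Fin n → ℝ) × ℝ | w z.1 < z.2} :=
    measurableSet_lt (H.measurable.comp measurable_fst) measurable_snd
  have h1 := H.integral_level_nonpos (q := q) (s := δ) (t := k * m) h hδ hD fun β hβ1 hβ2 =>
    H.setIntegral_level_lt h hp hQ hk (hδ.trans hβ1) hwm hβ2
  have i1 := H.integral_inner (q := q) (s := δ) (t := k * m) h hδ hD
  have step : ∫ x, -levelConst p k q * max (w x) δ ^ q ∂ν ≤
      ∫ x, ((∫ β in Ioc δ (k * m), {β | w x < β}.indicator
        (fun β => β ^ (q - p - 1) * tangentGap p Q (β / k) (w x)) β) +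
      (1 / (p - q) + (p - 1) / (p * k - p + 1) / (-q) - levelConst p k q) * (k * m) ^ q) ∂ν := by
    refine integral_mono_of_nonneg (Filter.Eventually.of_forall fun x => ?_)
      (i1.add (integrable_const _))
      (Filter.Eventually.of_forall fun x => h.rpow_max_le hp hq hc (H.pos x) hδ hδm)
    exact mul_nonneg (neg_nonneg.2 (h.levelConst_neg hp hq hc).le)
      (Real.rpow_nonneg (hδ.le.trans (le_max_right _ _)) _)
  have e : ∫ x, ((∫ β in Ioc δ (k * m), {β | w x < β}.indicator
        (fun β => β ^ (q - p - 1) * tangentGap p Q (β / k) (w x)) β) +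
      (1 / (p - q) + (p - 1) / (p * k - p + 1) / (-q) - levelConst p k q) * (k * m) ^ q) ∂ν =
      (∫ x, (∫ β in Ioc δ (k * m), {β | w x < β}.indicator
        (fun β => β ^ (q - p - 1) * tangentGap p Q (β / k) (w x)) β) ∂ν) +
      ν.real univ *
        ((1 / (p - q) + (p - 1) / (p * k - p + 1) / (-q) - levelConst p k q) * (k * m) ^ q) := by
    rw [← smul_eq_mul (ν.real univ), ← integral_const]
    exact integral_add i1 (integrable_const _)
  rw [e, integral_const_mul, Real.mul_rpow hk0.le hm.le] at step
  refine (step.trans (add_le_add_left h1 _)).trans (le_of_eq ?_)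
  ring

/-- Self-improvement to the exponents `q > p` below the critical one. -/
theorem exists_lintegral_rpow_le (h : IsContactRatio p Q k) (hp : 1 < p)
    (hQ : 1 < Q) (hk : k < 1) (hq : p < q) (hc : q * (1 - k) < 1) :
    ∃ C : ℝ, 0 < C ∧ ∀ (n : ℕ) (ν : Measure (Fin n → ℝ)) [IsFiniteMeasure ν]
      (w : (Fin n → ℝ) → ℝ) (a₀ b₀ : Fin n → ℝ) (m : ℝ), LocalRH ν p Q w a₀ b₀ → 0 < m →
      ∫ x, w x ∂ν = m * ν.real univ →
      ∫⁻ x, ENNReal.ofReal (w x ^ q) ∂ν ≤ ENNReal.ofReal (C * (m ^ q * ν.real univ)) := by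
  have hc0 := h.levelConst_pos hp hq hc
  have hk0 := h.pos
  have hd := h.den_pos
  refine ⟨(Q ^ p * (k ^ (q - p) / (q - p)) +
        ((p - 1) / (p * k - p + 1) / q + levelConst p k q) * k ^ q) / levelConst p k q, ?_, ?_⟩
  · have : 0 < q - p := by linarith
    have : 0 < q := by linarith
    have : 0 < p - 1 := by linarith
    positivity
  · intro n ν _ w a₀ b₀ m H hm hwm
    have hnn : ∀ (j : ℕ) x, 0 ≤ min (w x) (j : ℝ) ^ q := fun j x =>
      Real.rpow_nonneg (le_min (H.pos x).le (Nat.cast_nonneg j)) _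
    refine lintegral_rpow_le_of_truncation (fun j y => min y (j : ℝ) ^ q)
      (fun j => (measurable_id.min measurable_const).pow_const q) ?_ H.measurable H.pos hnn
      (fun j => ?_) ?_
    · intro y hy
      filter_upwards [tendsto_natCast_atTop_atTop.eventually_ge_atTop y] with j hj
      rw [min_eq_left hj]
    · refine Integrable.mono' (integrable_const ((j : ℝ) ^ q))
        ((H.measurable.min measurable_const).pow_const q).aestronglyMeasurable
        (Filter.Eventually.of_forall fun x => ?_)
      rw [Real.norm_of_nonneg (hnn j x)]
      exact Real.rpow_le_rpow (le_min (H.pos x).le (Nat.cast_nonneg j)) (min_le_right _ _)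
        (by linarith)
    · filter_upwards [tendsto_natCast_atTop_atTop.eventually_ge_atTop (k * m)] with j hj
      have := H.integral_min_rpow_le h hp hQ hk hq hc hm hwm hj
      rw [div_mul_eq_mul_div, le_div_iff₀ hc0]
      linarith

/-- Up to the exponent `p` nothing has to be improved: `y ^ q ≤ 1 + y ^ p`. -/
theorem lintegral_rpow_le_of_le (H : LocalRH ν p Q w a₀ b₀) (hq : 0 < q)
    (hqp : q ≤ p) {m : ℝ} (hm : 0 < m) (hwm : ∫ x, w x ∂ν = m * ν.real univ) :
    ∫⁻ x, ENNReal.ofReal (w x ^ q) ∂ν ≤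
      ENNReal.ofReal ((1 + Q ^ p) * (m ^ q * ν.real univ)) := by
  have hpt : ∀ x, w x ^ q ≤ m ^ q * (1 + w x ^ p / m ^ p) := by
    intro x
    have hy : 0 < w x / m := div_pos (H.pos x) hm
    have e : w x = m * (w x / m) := (mul_div_cancel₀ _ hm.ne').symm
    rw [← Real.div_rpow (H.pos x).le hm.le]
    nth_rewrite 1 [e]
    rw [Real.mul_rpow hm.le hy.le]
    gcongr
    have hp0 : 0 ≤ (w x / m) ^ p := by positivity
    rcases le_total (w x / m) 1 with h | h
    · have := Real.rpow_le_one hy.le h hq.le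
      linarith
    · have := Real.rpow_le_rpow_of_exponent_le h hqp
      linarith
  have i1 : Integrable (fun x => m ^ q * (1 + w x ^ p / m ^ p)) ν :=
    ((integrable_const _).add (H.integrable_rpow.div_const _)).const_mul _
  have hnn : ∀ x, 0 ≤ w x ^ q := fun x => Real.rpow_nonneg (H.pos x).le _
  calc ∫⁻ x, ENNReal.ofReal (w x ^ q) ∂ν
      ≤ ∫⁻ x, ENNReal.ofReal (m ^ q * (1 + w x ^ p / m ^ p)) ∂ν :=
        lintegral_mono fun x => ENNReal.ofReal_le_ofReal (hpt x)
    _ = ENNReal.ofReal (∫ x, m ^ q * (1 + w x ^ p / m ^ p) ∂ν) :=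
        (ofReal_integral_eq_lintegral_ofReal i1
          (Filter.Eventually.of_forall fun x => (hnn x).trans (hpt x))).symm
    _ ≤ _ := by
        apply ENNReal.ofReal_le_ofReal
        have hmp : 0 < m ^ p := by positivity
        have h1 := H.integral_rpow_le hm hwm
        rw [integral_const_mul, integral_add (integrable_const _) (H.integrable_rpow.div_const _),
          integral_const, smul_eq_mul, mul_one, integral_div]
        have h2 : (∫ x, w x ^ p ∂ν) / m ^ p ≤ Q ^ p * ν.real univ := by
          rw [div_le_iff₀ hmp]; linarith
        have h3 := mul_le_mul_of_nonneg_left h2 (show 0 ≤ m ^ q by positivity)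
        linarith

/-- Self-improvement to negative exponents above the critical one. -/
theorem exists_lintegral_rpow_neg_le (h : IsContactRatio p Q k) (hp : 1 < p)
    (hQ : 1 < Q) (hk : 1 < k) (hq : q < 0) (hc : q * (1 - k) < 1) :
    ∃ C : ℝ, 0 < C ∧ ∀ (n : ℕ) (ν : Measure (Fin n → ℝ)) [IsFiniteMeasure ν]
      (w : (Fin n → ℝ) → ℝ) (a₀ b₀ : Fin n → ℝ) (m : ℝ), LocalRH ν p Q w a₀ b₀ → 0 < m →
      ∫ x, w x ∂ν = m * ν.real univ →
      ∫⁻ x, ENNReal.ofReal (w x ^ q) ∂ν ≤ ENNReal.ofReal (C * (m ^ q * ν.real univ)) := by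
  have hc0 : 0 < -levelConst p k q := neg_pos.2 (h.levelConst_neg hp hq hc)
  have hk0 := h.pos
  have hd := h.den_pos
  refine ⟨((1 / (p - q) + (p - 1) / (p * k - p + 1) / (-q) - levelConst p k q) * k ^ q) /
    (-levelConst p k q), ?_, ?_⟩
  · have : 0 < p - q := by linarith
    have : 0 < -q := by linarith
    have : 0 < p - 1 := by linarith
    rw [sub_eq_add_neg]
    positivity
  · intro n ν _ w a₀ b₀ m H hm hwm
    have hδ : ∀ j : ℕ, 0 < 1 / ((j : ℝ) + 1) := fun j => by positivity
    have hmx : ∀ (j : ℕ) x, 0 < max (w x) (1 / ((j : ℝ) + 1)) := fun j x =>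
      lt_max_of_lt_left (H.pos x)
    have hnn : ∀ (j : ℕ) x, 0 ≤ max (w x) (1 / ((j : ℝ) + 1)) ^ q := fun j x =>
      Real.rpow_nonneg (hmx j x).le _
    refine lintegral_rpow_le_of_truncation (fun j y => max y (1 / ((j : ℝ) + 1)) ^ q)
      (fun j => (measurable_id.max measurable_const).pow_const q) ?_ H.measurable H.pos hnn
      (fun j => ?_) ?_
    · intro y hy
      filter_upwards [tendsto_one_div_add_atTop_nhds_zero_nat.eventually (gt_mem_nhds hy)]
        with j hj
      rw [max_eq_left hj.le]
    · refine Integrable.mono' (integrable_const ((1 / ((j : ℝ) + 1)) ^ q))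
        ((H.measurable.max measurable_const).pow_const q).aestronglyMeasurable
        (Filter.Eventually.of_forall fun x => ?_)
      rw [Real.norm_of_nonneg (hnn j x)]
      exact Real.rpow_le_rpow_of_nonpos (hδ j) (le_max_right _ _) hq.le
    · have hkm : 0 < k * m := by positivity
      filter_upwards [tendsto_one_div_add_atTop_nhds_zero_nat.eventually (gt_mem_nhds hkm)]
        with j hj
      have := H.integral_max_rpow_le h hp hQ hk hq hc hm hwm (hδ j) hj.le
      rw [div_mul_eq_mul_div, le_div_iff₀ hc0]
      linarith

end LocalRH

/-! ### Strong characteristics and half-open boxes -/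

section Characteristics

variable {n : ℕ} {μ : Measure (Fin n → ℝ)} {w w' : (Fin n → ℝ) → ℝ}

theorem avg_congr {f g : (Fin n → ℝ) → ℝ} (h : f =ᵐ[μ] g) (R : Set (Fin n → ℝ)) :
    avg μ R f = avg μ R g := by
  rw [avg, avg, lintegral_congr_ae]
  filter_upwards [ae_restrict_of_ae h] with x hx
  rw [hx]

theorem strongRHChar_congr (h : w =ᵐ[μ] w') (q : ℝ) :
    strongRHChar μ q w = strongRHChar μ q w' := by
  have h2 : (fun x => w x ^ q) =ᵐ[μ] fun x => w' x ^ q := by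
    filter_upwards [h] with x hx
    rw [hx]
  simp only [strongRHChar, avg_congr h, avg_congr h2]

theorem strongAChar_congr (h : w =ᵐ[μ] w') (q : ℝ) :
    strongAChar μ q w = strongAChar μ q w' := by
  have h2 : (fun x => w x ^ (-1 / (q - 1))) =ᵐ[μ] fun x => w' x ^ (-1 / (q - 1)) := by
    filter_upwards [h] with x hx
    rw [hx]
  simp only [strongAChar, avg_congr h, avg_congr h2]

theorem IsWeight.exists_measurable (hw : IsWeight μ w) :
    ∃ w' : (Fin n → ℝ) → ℝ, w =ᵐ[μ] w' ∧ Measurable w' ∧ (∀ x, 0 < w' x) ∧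
      LocallyIntegrable w' μ := by
  have hm := hw.locallyIntegrable.aestronglyMeasurable
  set v := hm.mk w
  have hv : Measurable v := hm.stronglyMeasurable_mk.measurable
  have mS : MeasurableSet {x | 0 < v x} := measurableSet_lt measurable_const hv
  have e : w =ᵐ[μ] {x | 0 < v x}.piecewise v (fun _ => 1) := by
    filter_upwards [hm.ae_eq_mk, hw.pos] with x hx hpos
    rw [Set.piecewise_eq_of_mem]
    · exact hx
    · change 0 < v x
      rwa [← show w x = v x from hx]
  refine ⟨_, e, Measurable.piecewise mS hv measurable_const, fun x => ?_, ?_⟩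
  · by_cases hx : 0 < v x
    · rw [Set.piecewise_eq_of_mem _ _ _ (show x ∈ {x | 0 < v x} from hx)]; exact hx
    · rw [Set.piecewise_eq_of_notMem _ _ _ (show x ∉ {x | 0 < v x} from hx)]; exact one_pos
  · intro x
    obtain ⟨s, hs, hi⟩ := hw.locallyIntegrable x
    exact ⟨s, hs, hi.congr (ae_restrict_of_ae e)⟩

theorem halfBox_ae_eq_Icc (hμ : ∀ (i : Fin n) (c : ℝ), μ {x | x i = c} = 0)
    (a b : Fin n → ℝ) : halfBox a b =ᵐ[μ] Icc a b := by
  have h0 : ∀ᵐ x ∂μ, ∀ i, x i ≠ a i := by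
    rw [ae_all_iff]
    intro i
    rw [ae_iff]
    simpa using hμ i (a i)
  rw [Filter.eventuallyEq_set]
  filter_upwards [h0] with x hx
  constructor
  · exact fun h => ⟨fun i => (h i).1.le, fun i => (h i).2⟩
  · exact fun h i => ⟨lt_of_le_of_ne (h.1 i) (hx i).symm, h.2 i⟩

theorem avg_eq_ofReal (hpos : ∀ x, 0 ≤ w x) {R : Set (Fin n → ℝ)} (hR : 0 < μ R)
    (hR2 : μ R ≠ ∞) (hi : IntegrableOn w R μ) :
    avg μ R w = ENNReal.ofReal ((∫ x in R, w x ∂μ) / μ.real R) := by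
  rw [avg, Measure.real, ENNReal.ofReal_div_of_pos (ENNReal.toReal_pos hR.ne' hR2),
    ofReal_integral_eq_lintegral_ofReal hi (Filter.Eventually.of_forall hpos),
    ENNReal.ofReal_toReal hR2]

theorem setIntegral_pos_of_pos (hpos : ∀ x, 0 < w x) {R : Set (Fin n → ℝ)} (hR : 0 < μ R)
    (hi : IntegrableOn w R μ) : 0 < ∫ x in R, w x ∂μ := by
  rw [integral_pos_iff_support_of_nonneg (fun x => (hpos x).le) hi]
  have : Function.support w = univ := by
    ext x; simp [(hpos x).ne']
  rw [this, Measure.restrict_apply_univ]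
  exact hR

theorem integrableOn_box (hloc : LocallyIntegrable w μ) {R : Set (Fin n → ℝ)}
    (hR : R ∈ boxes μ) : IntegrableOn w R μ := by
  obtain ⟨⟨a, b, -, rfl⟩, -⟩ := hR
  exact hloc.integrableOn_isCompact isCompact_Icc

variable [IsLocallyFiniteMeasure μ]

theorem measure_box_ne_top {R : Set (Fin n → ℝ)} (hR : R ∈ boxes μ) : μ R ≠ ∞ := by
  obtain ⟨⟨a, b, -, rfl⟩, -⟩ := hR
  exact isCompact_Icc.measure_ne_top

theorem rh_of_strongRHChar_le {p Q : ℝ} (hp : 1 < p) (hQ0 : 0 < Q) (hm : Measurable w)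
    (hpos : ∀ x, 0 < w x) (hloc : LocallyIntegrable w μ)
    (hQ : strongRHChar μ p w ≤ ENNReal.ofReal Q) {R : Set (Fin n → ℝ)} (hR : R ∈ boxes μ) :
    IntegrableOn (fun x => w x ^ p) R μ ∧
      ∫ x in R, w x ^ p ∂μ ≤ Q ^ p * ((∫ x in R, w x ∂μ) / μ.real R) ^ p * μ.real R := by
  have hfin := measure_box_ne_top hR
  have hi := integrableOn_box hloc hR
  have hμ0 : 0 < μ.real R := ENNReal.toReal_pos hR.2.ne' hfin
  have hM : 0 < (∫ x in R, w x ∂μ) / μ.real R :=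
    div_pos (setIntegral_pos_of_pos hpos hR.2 hi) hμ0
  have hp0 : 0 < p := by linarith
  have h1 : avg μ R (fun x => w x ^ p) ^ (1 / p) * (avg μ R w)⁻¹ ≤ ENNReal.ofReal Q :=
    (le_iSup₂ (f := fun R (_ : R ∈ boxes μ) =>
      avg μ R (fun x => w x ^ p) ^ (1 / p) * (avg μ R w)⁻¹) R hR).trans hQ
  rw [avg_eq_ofReal (fun x => (hpos x).le) hR.2 hfin hi] at h1
  set M := (∫ x in R, w x ∂μ) / μ.real R
  rw [← div_eq_mul_inv, ENNReal.div_le_iff (ENNReal.ofReal_pos.2 hM).ne' ENNReal.ofReal_ne_top,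
    ← ENNReal.ofReal_mul hQ0.le, one_div, ENNReal.rpow_inv_le_iff hp0,
    ENNReal.ofReal_rpow_of_pos (by positivity), avg,
    ENNReal.div_le_iff hR.2.ne' hfin] at h1
  have hmeas : AEStronglyMeasurable (fun x => w x ^ p) (μ.restrict R) :=
    (hm.pow_const p).aestronglyMeasurable
  have hnn : ∀ᵐ x ∂(μ.restrict R), 0 ≤ w x ^ p :=
    Filter.Eventually.of_forall fun x => Real.rpow_nonneg (hpos x).le _
  have hlt : ENNReal.ofReal ((Q * M) ^ p) * μ R < ∞ :=
    ENNReal.mul_lt_top ENNReal.ofReal_lt_top hfin.lt_top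
  refine ⟨⟨hmeas, (hasFiniteIntegral_iff_ofReal hnn).2 (h1.trans_lt hlt)⟩, ?_⟩
  rw [integral_eq_lintegral_of_nonneg_ae hnn hmeas, ← Real.mul_rpow hQ0.le hM.le]
  refine (ENNReal.toReal_mono hlt.ne h1).trans (le_of_eq ?_)
  rw [ENNReal.toReal_mul, ENNReal.toReal_ofReal (by positivity), Measure.real]

theorem localRH_of_strongRHChar_le {p Q : ℝ} (hp : 1 < p) (hQ0 : 0 < Q) (hm : Measurable w)
    (hpos : ∀ x, 0 < w x) (hloc : LocallyIntegrable w μ)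
    (hμ : ∀ (i : Fin n) (c : ℝ), μ {x | x i = c} = 0)
    (hQ : strongRHChar μ p w ≤ ENNReal.ofReal Q) {a₀ b₀ : Fin n → ℝ}
    (hab : ∀ i, a₀ i < b₀ i) (hR : 0 < μ (Icc a₀ b₀)) :
    LocalRH (μ.restrict (halfBox a₀ b₀)) p Q w a₀ b₀ where
  null i c := le_antisymm ((Measure.restrict_apply_le _ _).trans (hμ i c).le) bot_le
  le i := (hab i).le
  ae_mem := ae_restrict_mem (measurableSet_halfBox a₀ b₀)
  measurable := hm
  pos := hpos
  integrable := (hloc.integrableOn_isCompact isCompact_Icc).congr_set_ae (halfBox_ae_eq_Icc hμ _ _)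
  integrable_rpow := (rh_of_strongRHChar_le hp hQ0 hm hpos hloc hQ
    ⟨⟨a₀, b₀, hab, rfl⟩, hR⟩).1.congr_set_ae (halfBox_ae_eq_Icc hμ _ _)
  rh a b α ha _ hb hα h := by
    have hsub : halfBox a b ⊆ halfBox a₀ b₀ := halfBox_subset ha hb
    have e := halfBox_ae_eq_Icc hμ a b
    rw [Measure.real, Measure.restrict_apply (measurableSet_halfBox a b),
      inter_eq_left.2 hsub, Measure.restrict_restrict_of_subset hsub] at *
    rcases eq_or_ne (μ (halfBox a b)) 0 with h0 | h0
    · rw [Measure.restrict_eq_zero.2 h0, h0]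
      simp
    · obtain ⟨x, hx⟩ := nonempty_of_measure_ne_zero h0
      have hbox : Icc a b ∈ boxes μ :=
        ⟨⟨a, b, fun i => (hx i).1.trans_le (hx i).2, rfl⟩, by
          rw [← measure_congr e]; exact pos_iff_ne_zero.2 h0⟩
      have h1 := (rh_of_strongRHChar_le hp hQ0 hm hpos hloc hQ hbox).2
      have hμ0 : 0 < μ.real (Icc a b) :=
        ENNReal.toReal_pos hbox.2.ne' (measure_box_ne_top hbox)
      rw [measure_congr e, setIntegral_congr_set e] at *
      rw [h] at h1
      rwa [← Measure.real, mul_div_cancel_right₀ _ hμ0.ne'] at h1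

/-- The averages over a box inherit the estimates proved under the condition `LocalRH`. -/
theorem exists_avg_le {p Q q C : ℝ} (hp : 1 < p) (hQ0 : 0 < Q) (hC : 0 < C)
    (H : ∀ (n : ℕ) (ν : Measure (Fin n → ℝ)) [IsFiniteMeasure ν]
      (w : (Fin n → ℝ) → ℝ) (a₀ b₀ : Fin n → ℝ) (m : ℝ), LocalRH ν p Q w a₀ b₀ → 0 < m →
      ∫ x, w x ∂ν = m * ν.real univ →
      ∫⁻ x, ENNReal.ofReal (w x ^ q) ∂ν ≤ ENNReal.ofReal (C * (m ^ q * ν.real univ)))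
    (hm : Measurable w) (hpos : ∀ x, 0 < w x) (hloc : LocallyIntegrable w μ)
    (hμ : ∀ (i : Fin n) (c : ℝ), μ {x | x i = c} = 0)
    (hQ : strongRHChar μ p w ≤ ENNReal.ofReal Q) {R : Set (Fin n → ℝ)} (hR : R ∈ boxes μ) :
    ∃ m : ℝ, 0 < m ∧ avg μ R w = ENNReal.ofReal m ∧
      avg μ R (fun x => w x ^ q) ≤ ENNReal.ofReal (C * m ^ q) := by
  have hfin := measure_box_ne_top hR
  have hi := integrableOn_box hloc hR
  have hμ0 : 0 < μ.real R := ENNReal.toReal_pos hR.2.ne' hfin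
  have hM : 0 < (∫ x in R, w x ∂μ) / μ.real R :=
    div_pos (setIntegral_pos_of_pos hpos hR.2 hi) hμ0
  refine ⟨_, hM, avg_eq_ofReal (fun x => (hpos x).le) hR.2 hfin hi, ?_⟩
  obtain ⟨⟨a, b, hab, rfl⟩, hR0⟩ := hR
  have e := Measure.restrict_congr_set (halfBox_ae_eq_Icc hμ a b)
  have : IsFiniteMeasure (μ.restrict (Icc a b)) := isFiniteMeasure_restrict.2 hfin
  have hL := localRH_of_strongRHChar_le hp hQ0 hm hpos hloc hμ hQ hab hR0
  rw [e] at hL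
  have h1 := H n (μ.restrict (Icc a b)) w a b _ hL hM ?_
  · rw [avg, ENNReal.div_le_iff hR0.ne' hfin]
    refine h1.trans (le_of_eq ?_)
    rw [measureReal_restrict_apply_univ, ← mul_assoc, ENNReal.ofReal_mul (by positivity),
      Measure.real, ENNReal.ofReal_toReal hfin]
  · rw [measureReal_restrict_apply_univ, div_mul_cancel₀ _ hμ0.ne']

end Characteristics

/-! ### Self-improvement -/

theorem exists_strongAChar_le {p Q k q : ℝ} (h : IsContactRatio p Q k) (hp : 1 < p)
    (hQ : 1 < Q) (hk : 1 < k) (hq : k < q) :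
    ∃ C : ℝ≥0, ∀ (n : ℕ) (μ : Measure (Fin n → ℝ)) [IsLocallyFiniteMeasure μ],
      (∀ (i : Fin n) (c : ℝ), μ {x | x i = c} = 0) →
      ∀ w : (Fin n → ℝ) → ℝ, IsWeight μ w → strongRHChar μ p w = ENNReal.ofReal Q →
        MemStrongA μ q w ∧ strongAChar μ q w ≤ C := by
  have hq1 : 0 < q - 1 := by linarith
  have hr : -1 / (q - 1) < 0 := div_neg_of_neg_of_pos (by norm_num) hq1
  obtain ⟨C, hC, H⟩ := LocalRH.exists_lintegral_rpow_neg_le h hp hQ hk hr (by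
    rw [div_mul_eq_mul_div, div_lt_one hq1]; linarith)
  suffices hs : ∀ (n : ℕ) (μ : Measure (Fin n → ℝ)) [IsLocallyFiniteMeasure μ],
      (∀ (i : Fin n) (c : ℝ), μ {x | x i = c} = 0) →
      ∀ w : (Fin n → ℝ) → ℝ, IsWeight μ w → strongRHChar μ p w = ENNReal.ofReal Q →
        strongAChar μ q w ≤ (C ^ (q - 1)).toNNReal by
    exact ⟨(C ^ (q - 1)).toNNReal, fun n μ _ hμ w hw hwQ =>
      ⟨(hs n μ hμ w hw hwQ).trans_lt ENNReal.coe_lt_top, hs n μ hμ w hw hwQ⟩⟩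
  intro n μ _ hμ w hw hwQ
  obtain ⟨w', hww', hm, hpos, hloc⟩ := hw.exists_measurable
  rw [strongRHChar_congr hww'] at hwQ
  rw [strongAChar_congr hww']
  refine iSup₂_le fun R hR => ?_
  obtain ⟨m, hm0, e1, e2⟩ := exists_avg_le hp (by linarith) hC H hm hpos hloc hμ hwQ.le hR
  rw [e1]
  calc ENNReal.ofReal m * avg μ R (fun x => w' x ^ (-1 / (q - 1))) ^ (q - 1)
      ≤ ENNReal.ofReal m * ENNReal.ofReal (C * m ^ (-1 / (q - 1))) ^ (q - 1) := by
        gcongr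
    _ = ENNReal.ofReal (C ^ (q - 1)) := by
        rw [ENNReal.ofReal_rpow_of_pos (by positivity), ← ENNReal.ofReal_mul hm0.le,
          Real.mul_rpow hC.le (by positivity), ← Real.rpow_mul hm0.le,
          div_mul_cancel₀ _ hq1.ne', Real.rpow_neg_one]
        congr 1
        field_simp

theorem exists_strongRHChar_le {p Q k q : ℝ} (h : IsContactRatio p Q k) (hp : 1 < p)
    (hQ : 1 < Q) (hk : k < 1) (hq : 1 ≤ q) (hc : q * (1 - k) < 1) :
    ∃ C : ℝ≥0, ∀ (n : ℕ) (μ : Measure (Fin n → ℝ)) [IsLocallyFiniteMeasure μ],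
      (∀ (i : Fin n) (c : ℝ), μ {x | x i = c} = 0) →
      ∀ w : (Fin n → ℝ) → ℝ, IsWeight μ w → strongRHChar μ p w = ENNReal.ofReal Q →
        MemStrongRH μ q w ∧ strongRHChar μ q w ≤ C := by
  have hq0 : 0 < q := by linarith
  have hQ0 : 0 < Q := by linarith
  obtain ⟨C, hC, H⟩ : ∃ C : ℝ, 0 < C ∧ ∀ (n : ℕ) (ν : Measure (Fin n → ℝ)) [IsFiniteMeasure ν]
      (w : (Fin n → ℝ) → ℝ) (a₀ b₀ : Fin n → ℝ) (m : ℝ), LocalRH ν p Q w a₀ b₀ → 0 < m →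
      ∫ x, w x ∂ν = m * ν.real univ →
      ∫⁻ x, ENNReal.ofReal (w x ^ q) ∂ν ≤ ENNReal.ofReal (C * (m ^ q * ν.real univ)) := by
    rcases le_or_gt q p with hqp | hqp
    · exact ⟨1 + Q ^ p, by positivity, fun n ν _ w a₀ b₀ m hL hm hwm =>
        hL.lintegral_rpow_le_of_le hq0 hqp hm hwm⟩
    · exact LocalRH.exists_lintegral_rpow_le h hp hQ hk hqp hc
  suffices hs : ∀ (n : ℕ) (μ : Measure (Fin n → ℝ)) [IsLocallyFiniteMeasure μ],
      (∀ (i : Fin n) (c : ℝ), μ {x | x i = c} = 0) →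
      ∀ w : (Fin n → ℝ) → ℝ, IsWeight μ w → strongRHChar μ p w = ENNReal.ofReal Q →
        strongRHChar μ q w ≤ (C ^ (1 / q)).toNNReal by
    exact ⟨(C ^ (1 / q)).toNNReal, fun n μ _ hμ w hw hwQ =>
      ⟨(hs n μ hμ w hw hwQ).trans_lt ENNReal.coe_lt_top, hs n μ hμ w hw hwQ⟩⟩
  intro n μ _ hμ w hw hwQ
  obtain ⟨w', hww', hm, hpos, hloc⟩ := hw.exists_measurable
  rw [strongRHChar_congr hww'] at hwQ ⊢
  refine iSup₂_le fun R hR => ?_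
  obtain ⟨m, hm0, e1, e2⟩ := exists_avg_le hp hQ0 hC H hm hpos hloc hμ hwQ.le hR
  rw [e1]
  calc avg μ R (fun x => w' x ^ q) ^ (1 / q) * (ENNReal.ofReal m)⁻¹
      ≤ ENNReal.ofReal (C * m ^ q) ^ (1 / q) * (ENNReal.ofReal m)⁻¹ := by
        gcongr
    _ = ENNReal.ofReal (C ^ (1 / q)) := by
        rw [ENNReal.ofReal_rpow_of_pos (by positivity), ← ENNReal.ofReal_inv_of_pos hm0,
          ← ENNReal.ofReal_mul (by positivity), Real.mul_rpow hC.le (by positivity),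
          ← Real.rpow_mul hm0.le, mul_one_div_cancel hq0.ne', Real.rpow_one]
        congr 1
        field_simp

/-! ### Pieces of weights on the line -/

/-- The functions that are composed with weights: their composition with a measurable function
with values in a compact subset of `(0, ∞)` is bounded and measurable. -/
structure IsGauge (F : ℝ → ℝ) : Prop where
  measurable : Measurable F
  continuousOn : ContinuousOn F (Ioi 0)

theorem isGauge_rpow (e : ℝ) : IsGauge fun x => x ^ e :=
  ⟨measurable_id.pow_const e, fun x hx =>
    (Real.continuousAt_rpow_const x e (Or.inl (ne_of_gt hx))).continuousWithinAt⟩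

theorem isGauge_id : IsGauge fun x => x := ⟨measurable_id, continuousOn_id⟩

theorem isGauge_tangentGap (p Q m : ℝ) : IsGauge (tangentGap p Q m) :=
  ⟨((measurable_id.pow_const p).sub (measurable_id.const_mul _)).add_const _,
    ((isGauge_rpow p).continuousOn.sub (continuousOn_const.mul continuousOn_id)).add
      continuousOn_const⟩

theorem IsGauge.comp_mul {F : ℝ → ℝ} (hF : IsGauge F) {l : ℝ} (hl : 0 < l) :
    IsGauge fun x => F (l * x) :=
  ⟨hF.measurable.comp (measurable_const_mul l), hF.continuousOn.comp
    (continuousOn_const.mul continuousOn_id) fun _ hx => mul_pos hl hx⟩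

/-- A measurable positive function that is bounded above and away from zero on `[a, b)`. -/
structure IsTame (W : ℝ → ℝ) (a b : ℝ) : Prop where
  measurable : Measurable W
  pos : ∀ x, 0 < W x
  bounds : ∃ lo hi, 0 < lo ∧ ∀ x ∈ Ico a b, W x ∈ Icc lo hi

theorem IsTame.intervalIntegrable {W : ℝ → ℝ} {a b : ℝ} (hW : IsTame W a b) {F : ℝ → ℝ}
    (hF : IsGauge F) {c d : ℝ} (hc : a ≤ c) (hcd : c ≤ d) (hd : d ≤ b) :
    IntervalIntegrable (fun x => F (W x)) volume c d := by
  obtain ⟨lo, hi, hlo, hb⟩ := hW.bounds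
  obtain ⟨C, hC⟩ := isCompact_Icc.exists_bound_of_continuousOn
    (hF.continuousOn.mono (fun x (hx : x ∈ Icc lo hi) => hlo.trans_le hx.1))
  rw [intervalIntegrable_iff_integrableOn_Ico_of_le hcd]
  refine Measure.integrableOn_of_bounded (M := C) (by simp)
    (hF.measurable.comp hW.measurable).aestronglyMeasurable ?_
  filter_upwards [ae_restrict_mem measurableSet_Ico] with x hx
  exact hC _ (hb x ⟨hc.trans hx.1, hx.2.trans_le hd⟩)

theorem IsTame.integral_add {W : ℝ → ℝ} {a b : ℝ} (hW : IsTame W a b) {F : ℝ → ℝ}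
    (hF : IsGauge F) {c d e : ℝ} (hc : a ≤ c) (hcd : c ≤ d) (hde : d ≤ e) (he : e ≤ b) :
    ∫ x in c..e, F (W x) = (∫ x in c..d, F (W x)) + ∫ x in d..e, F (W x) :=
  (intervalIntegral.integral_add_adjacent_intervals
    (hW.intervalIntegrable hF hc hcd (hde.trans he))
    (hW.intervalIntegrable hF (hc.trans hcd) hde he)).symm

theorem integral_congr_Ico {f g : ℝ → ℝ} {c d : ℝ} (hcd : c ≤ d)
    (h : ∀ x ∈ Ico c d, f x = g x) : ∫ x in c..d, f x = ∫ x in c..d, g x := by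
  rw [intervalIntegral.integral_of_le hcd, intervalIntegral.integral_of_le hcd,
    ← integral_Ico_eq_integral_Ioc, ← integral_Ico_eq_integral_Ioc]
  exact setIntegral_congr_fun measurableSet_Ico h

/-- The function equal to `W₁` before `c` and to `W₂` from `c` on. -/
noncomputable def joinAt (c : ℝ) (W₁ W₂ : ℝ → ℝ) (x : ℝ) : ℝ := if x < c then W₁ x else W₂ x

theorem IsTame.join {W₁ W₂ : ℝ → ℝ} {a b c : ℝ} (h1 : IsTame W₁ a c) (h2 : IsTame W₂ c b) :
    IsTame (joinAt c W₁ W₂) a b := by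
  obtain ⟨lo, hi, hlo, hb⟩ := h1.bounds
  obtain ⟨lo', hi', hlo', hb'⟩ := h2.bounds
  refine ⟨Measurable.ite measurableSet_Iio h1.measurable h2.measurable, fun x => ?_,
    min lo lo', max hi hi', lt_min hlo hlo', fun x hx => ?_⟩
  · unfold joinAt
    split_ifs
    exacts [h1.pos x, h2.pos x]
  · unfold joinAt
    split_ifs with h
    · have := hb x ⟨hx.1, h⟩
      exact ⟨(min_le_left _ _).trans this.1, this.2.trans (le_max_left _ _)⟩
    · have := hb' x ⟨not_lt.1 h, hx.2⟩
      exact ⟨(min_le_right _ _).trans this.1, this.2.trans (le_max_right _ _)⟩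

theorem integral_joinAt_left {W₁ W₂ F : ℝ → ℝ} {c y z : ℝ} (hyz : y ≤ z) (hz : z ≤ c) :
    ∫ x in y..z, F (joinAt c W₁ W₂ x) = ∫ x in y..z, F (W₁ x) :=
  integral_congr_Ico hyz fun x hx => by rw [joinAt, if_pos (hx.2.trans_le hz)]

theorem integral_joinAt_right {W₁ W₂ F : ℝ → ℝ} {c y z : ℝ} (hyz : y ≤ z) (hy : c ≤ y) :
    ∫ x in y..z, F (joinAt c W₁ W₂ x) = ∫ x in y..z, F (W₂ x) :=
  integral_congr_Ico hyz fun x hx => by rw [joinAt, if_neg (not_lt.2 (hy.trans hx.1))]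

/-- A weight on `[a, b)` all of whose subintervals satisfy the reverse Hölder inequality, witnessed
by nonpositive integrals of tangent gaps. For the intervals that share an end with `[a, b)` the
point of tangency is the prescribed `m`. -/
structure IsPiece (p Q m : ℝ) (W : ℝ → ℝ) (a b : ℝ) : Prop where
  tame : IsTame W a b
  rh : ∀ c d, a ≤ c → c ≤ d → d ≤ b → ∃ m' > 0, ∫ x in c..d, tangentGap p Q m' (W x) ≤ 0
  left : ∀ x, a ≤ x → x ≤ b → ∫ t in a..x, tangentGap p Q m (W t) ≤ 0
  right : ∀ x, a ≤ x → x ≤ b → ∫ t in x..b, tangentGap p Q m (W t) ≤ 0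

theorem isTame_const {u : ℝ} (hu : 0 < u) (a b : ℝ) : IsTame (fun _ => u) a b :=
  ⟨measurable_const, fun _ => hu, u, u, hu, fun _ _ => ⟨le_rfl, le_rfl⟩⟩

theorem isPiece_const {p Q m u : ℝ} (hm : 0 < m) (hu : 0 < u) (h : tangentGap p Q m u ≤ 0)
    (a b : ℝ) : IsPiece p Q m (fun _ => u) a b := by
  have key : ∀ c d : ℝ, c ≤ d → ∫ _ in c..d, tangentGap p Q m u ≤ 0 := by
    intro c d hcd
    rw [intervalIntegral.integral_const, smul_eq_mul]
    exact mul_nonpos_of_nonneg_of_nonpos (sub_nonneg.2 hcd) h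
  exact ⟨isTame_const hu a b, fun c d _ hcd _ => ⟨m, hm, key c d hcd⟩, fun x hx _ => key a x hx,
    fun x _ hx => key x b hx⟩

/-- Pieces with the same point of tangency can be joined: an interval meeting both is made of a
final part of the first and an initial part of the second. -/
theorem IsPiece.join {p Q m : ℝ} {W₁ W₂ : ℝ → ℝ} {a b c : ℝ} (hm : 0 < m)
    (h1 : IsPiece p Q m W₁ a c) (h2 : IsPiece p Q m W₂ c b) (hac : a ≤ c) (hcb : c ≤ b) :
    IsPiece p Q m (joinAt c W₁ W₂) a b := by
  have hg := isGauge_tangentGap p Q m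
  have ht := h1.tame.join h2.tame
  have e1 : ∀ y, a ≤ y → y ≤ c →
      ∫ x in y..c, tangentGap p Q m (joinAt c W₁ W₂ x) ≤ 0 := fun y hy hyc => by
    rw [integral_joinAt_left hyc le_rfl]; exact h1.right y hy hyc
  have e2 : ∀ y, c ≤ y → y ≤ b →
      ∫ x in c..y, tangentGap p Q m (joinAt c W₁ W₂ x) ≤ 0 := fun y hy hyb => by
    rw [integral_joinAt_right hy le_rfl]; exact h2.left y hy hyb
  have e3 : ∀ y z, a ≤ y → y ≤ c → c ≤ z → z ≤ b →
      ∫ x in y..z, tangentGap p Q m (joinAt c W₁ W₂ x) ≤ 0 := fun y z h1 h2 h3 h4 => by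
    rw [ht.integral_add hg h1 h2 h3 h4]
    linarith [e1 y h1 h2, e2 z h3 h4]
  refine ⟨ht, fun y z hy hyz hz => ?_, fun x hx hxb => ?_, fun x hx hxb => ?_⟩
  · rcases le_total z c with hzc | hzc
    · obtain ⟨m', hm', h⟩ := h1.rh y z hy hyz hzc
      exact ⟨m', hm', by rwa [integral_joinAt_left hyz hzc]⟩
    · rcases le_total c y with hyc | hyc
      · obtain ⟨m', hm', h⟩ := h2.rh y z hyc hyz hz
        exact ⟨m', hm', by rwa [integral_joinAt_right hyz hyc]⟩
      · exact ⟨m, hm, e3 y z hy hyc hzc hz⟩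
  · rcases le_total x c with hxc | hxc
    · rw [integral_joinAt_left hx hxc]; exact h1.left x hx hxc
    · exact e3 a x le_rfl hac hxc hxb
  · rcases le_total x c with hxc | hxc
    · exact e3 x b hx hxc hcb le_rfl
    · rw [integral_joinAt_right hxb hxc]; exact h2.right x hxc hxb

theorem IsPiece.congr {p Q m : ℝ} {W W' : ℝ → ℝ} {a b : ℝ} (h : IsPiece p Q m W a b)
    (hm : Measurable W') (hpos : ∀ x, 0 < W' x) (he : ∀ x ∈ Ico a b, W' x = W x) :
    IsPiece p Q m W' a b := by
  obtain ⟨lo, hi, hlo, hb⟩ := h.tame.bounds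
  have key : ∀ m' c d, a ≤ c → c ≤ d → d ≤ b → ∫ x in c..d, tangentGap p Q m' (W' x) =
      ∫ x in c..d, tangentGap p Q m' (W x) := fun m' c d hc hcd hd =>
    integral_congr_Ico hcd fun x hx => by rw [he x ⟨hc.trans hx.1, hx.2.trans_le hd⟩]
  refine ⟨⟨hm, hpos, lo, hi, hlo, fun x hx => by rw [he x hx]; exact hb x hx⟩,
    fun c d hc hcd hd => ?_, fun x hx hxb => ?_, fun x hx hxb => ?_⟩
  · obtain ⟨m', hm', h⟩ := h.rh c d hc hcd hd
    exact ⟨m', hm', by rwa [key m' c d hc hcd hd]⟩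
  · rw [key m a x le_rfl hx hxb]; exact h.left x hx hxb
  · rw [key m x b hx hxb le_rfl]; exact h.right x hx hxb

/-- The copy of `l * W` on `[r * d, r * d + r)`, where `W` is given on `[0, 1)`. -/
noncomputable def copyAt (l r d : ℝ) (W : ℝ → ℝ) (x : ℝ) : ℝ := l * W (x / r - d)

theorem integral_copyAt {l r d : ℝ} (hr : 0 < r) (F W : ℝ → ℝ) (y z : ℝ) :
    ∫ x in y..z, F (copyAt l r d W x) = r * ∫ x in (y / r - d)..(z / r - d), F (l * W x) :=
  intervalIntegral.integral_comp_div_sub (fun x => F (l * W x)) hr.ne' d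

theorem IsTame.copy {l r d : ℝ} (hl : 0 < l) (hr : 0 < r) {W : ℝ → ℝ} (h : IsTame W 0 1) :
    IsTame (copyAt l r d W) (r * d) (r * d + r) := by
  obtain ⟨lo, hi, hlo, hb⟩ := h.bounds
  refine ⟨(h.measurable.comp ((measurable_id.div_const r).sub_const d)).const_mul l,
    fun x => mul_pos hl (h.pos _), l * lo, l * hi, by positivity, fun x hx => ?_⟩
  have := hb (x / r - d) ⟨by rw [sub_nonneg, le_div_iff₀ hr]; linarith [hx.1], by
    rw [sub_lt_iff_lt_add, div_lt_iff₀ hr]; linarith [hx.2]⟩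
  exact ⟨mul_le_mul_of_nonneg_left this.1 hl.le, mul_le_mul_of_nonneg_left this.2 hl.le⟩

theorem IsPiece.copy {p Q m l r d : ℝ} (hm : 0 < m) (hl : 0 < l) (hr : 0 < r) {W : ℝ → ℝ}
    (h : IsPiece p Q m W 0 1) :
    IsPiece p Q (l * m) (copyAt l r d W) (r * d) (r * d + r) := by
  have key : ∀ m' > 0, ∀ y z, ∫ x in y..z, tangentGap p Q (l * m') (copyAt l r d W x) =
      r * (l ^ p * ∫ x in (y / r - d)..(z / r - d), tangentGap p Q m' (W x)) := by
    intro m' hm' y z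
    have e : ∀ x, tangentGap p Q (l * m') (l * W x) = l ^ p * tangentGap p Q m' (W x) :=
      fun x => tangentGap_mul_mul hl hm'.le (h.tame.pos x).le
    rw [integral_copyAt hr (tangentGap p Q (l * m'))]
    simp only [e, intervalIntegral.integral_const_mul]
  have hrl : 0 ≤ l ^ p := by positivity
  have h0 : r * d / r - d = 0 := by field_simp; ring
  have h1 : (r * d + r) / r - d = 1 := by field_simp; ring
  have hlo : ∀ y, r * d ≤ y → 0 ≤ y / r - d := fun y hy => by
    rw [sub_nonneg, le_div_iff₀ hr]; linarith
  have hhi : ∀ y, y ≤ r * d + r → y / r - d ≤ 1 := fun y hy => by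
    rw [sub_le_iff_le_add, div_le_iff₀ hr]; linarith
  refine ⟨h.tame.copy hl hr, fun y z hy hyz hz => ?_, fun x hx hxb => ?_, fun x hx hxb => ?_⟩
  · obtain ⟨m', hm', hi⟩ := h.rh (y / r - d) (z / r - d) (hlo y hy) (by gcongr) (hhi z hz)
    refine ⟨l * m', by positivity, ?_⟩
    rw [key m' hm']
    exact mul_nonpos_of_nonneg_of_nonpos hr.le (mul_nonpos_of_nonneg_of_nonpos hrl hi)
  · rw [key m hm, h0]
    exact mul_nonpos_of_nonneg_of_nonpos hr.le (mul_nonpos_of_nonneg_of_nonpos hrl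
      (h.left _ (hlo x hx) (hhi x hxb)))
  · rw [key m hm, h1]
    exact mul_nonpos_of_nonneg_of_nonpos hr.le (mul_nonpos_of_nonneg_of_nonpos hrl
      (h.right _ (hlo x hx) (hhi x hxb)))

/-- Two half-size copies of `W` side by side. -/
noncomputable def double (W : ℝ → ℝ) : ℝ → ℝ :=
  joinAt (1 / 2) (copyAt 1 (1 / 2) 0 W) (copyAt 1 (1 / 2) 1 W)

theorem IsPiece.two_copies {p Q : ℝ} {W : ℝ → ℝ} (h : IsPiece p Q 1 W 0 1) :
    IsPiece p Q 1 (double W) 0 1 := by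
  have h1 := h.copy (l := 1) (r := 1 / 2) (d := 0) one_pos one_pos (by norm_num)
  have h2 := h.copy (l := 1) (r := 1 / 2) (d := 1) one_pos one_pos (by norm_num)
  norm_num at h1 h2
  have := h1.join one_pos h2 (by norm_num) (by norm_num)
  simpa [double] using this

theorem integral_double_left {W F : ℝ → ℝ} {x : ℝ} (h0 : 0 ≤ x) (hx : x ≤ 1 / 2) :
    ∫ t in 0..x, F (double W t) = 1 / 2 * ∫ t in 0..(2 * x), F (W t) := by
  rw [double, integral_joinAt_left h0 hx, integral_copyAt (by norm_num)]
  simp only [one_mul]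
  congr 2 <;> ring

theorem integral_double_right {W F : ℝ → ℝ} {x : ℝ} (h0 : 1 / 2 ≤ x) (hx : x ≤ 1) :
    ∫ t in x..1, F (double W t) = 1 / 2 * ∫ t in (2 * x - 1)..1, F (W t) := by
  rw [double, integral_joinAt_right hx h0, integral_copyAt (by norm_num)]
  simp only [one_mul]
  congr 2 <;> ring

theorem integral_double_half {W F : ℝ → ℝ} {x : ℝ} (h0 : 1 / 2 ≤ x) :
    ∫ t in (1 / 2)..x, F (double W t) = 1 / 2 * ∫ t in 0..(2 * x - 1), F (W t) := by
  rw [double, integral_joinAt_right h0 le_rfl, integral_copyAt (by norm_num)]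
  simp only [one_mul]
  congr 2 <;> ring

theorem integral_double_half' {W F : ℝ → ℝ} {x : ℝ} (hx : x ≤ 1 / 2) :
    ∫ t in x..(1 / 2), F (double W t) = 1 / 2 * ∫ t in (2 * x)..1, F (W t) := by
  rw [double, integral_joinAt_left hx le_rfl, integral_copyAt (by norm_num)]
  simp only [one_mul]
  congr 2 <;> ring

theorem IsPiece.integral_double {p Q : ℝ} {W F : ℝ → ℝ} (h : IsPiece p Q 1 W 0 1)
    (hF : IsGauge F) : ∫ t in 0..1, F (double W t) = ∫ t in 0..1, F (W t) := by
  rw [h.two_copies.tame.integral_add hF (d := 1 / 2) le_rfl (by norm_num) (by norm_num) le_rfl,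
    integral_double_left (by norm_num) le_rfl, integral_double_right le_rfl (by norm_num)]
  norm_num
  ring

/-- Replacing `W` by many small copies of itself keeps all moments, and makes the partial integrals
of a function with nonpositive total integral as small as desired. -/
theorem IsPiece.exists_homogenized {p Q : ℝ} {W G : ℝ → ℝ} (h : IsPiece p Q 1 W 0 1)
    (hG : IsGauge G) (hG0 : ∫ t in 0..1, G (W t) ≤ 0) {η : ℝ} (hη : 0 < η) :
    ∃ V : ℝ → ℝ, IsPiece p Q 1 V 0 1 ∧
      (∀ F : ℝ → ℝ, IsGauge F → ∫ t in 0..1, F (V t) = ∫ t in 0..1, F (W t)) ∧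
      ∀ x, 0 ≤ x → x ≤ 1 → ∫ t in 0..x, G (V t) ≤ η ∧ ∫ t in x..1, G (V t) ≤ η := by
  obtain ⟨B, hB0, hB⟩ : ∃ B : ℝ, 0 ≤ B ∧ ∀ x, 0 ≤ x → x ≤ 1 →
      ∫ t in 0..x, G (W t) ≤ B ∧ ∫ t in x..1, G (W t) ≤ B := by
    have hi := h.tame.intervalIntegrable hG le_rfl zero_le_one le_rfl
    refine ⟨∫ t in 0..1, |G (W t)|, intervalIntegral.integral_nonneg zero_le_one
      fun t _ => abs_nonneg _, fun x h0 h1 => ⟨?_, ?_⟩⟩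
    · have := intervalIntegral.abs_integral_le_integral_abs (f := fun t => G (W t))
        (μ := volume) h0
      have h2 := intervalIntegral.integral_mono_interval (f := fun t => |G (W t)|) (μ := volume)
        (a := 0) (b := x) (c := 0) (d := 1) le_rfl h0 h1
        (Filter.Eventually.of_forall fun t => abs_nonneg _) hi.abs
      linarith [le_abs_self (∫ t in 0..x, G (W t))]
    · have := intervalIntegral.abs_integral_le_integral_abs (f := fun t => G (W t))
        (μ := volume) h1
      have h2 := intervalIntegral.integral_mono_interval (f := fun t => |G (W t)|) (μ := volume)
        (a := x) (b := 1) (c := 0) (d := 1) h0 h1 le_rfl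
        (Filter.Eventually.of_forall fun t => abs_nonneg _) hi.abs
      linarith [le_abs_self (∫ t in x..1, G (W t))]
  have key : ∀ j : ℕ, ∃ V : ℝ → ℝ, IsPiece p Q 1 V 0 1 ∧
      (∀ F : ℝ → ℝ, IsGauge F → ∫ t in 0..1, F (V t) = ∫ t in 0..1, F (W t)) ∧
      ∀ x, 0 ≤ x → x ≤ 1 →
        ∫ t in 0..x, G (V t) ≤ B * (1 / 2) ^ j ∧ ∫ t in x..1, G (V t) ≤ B * (1 / 2) ^ j := by
    intro j
    induction j with
    | zero => exact ⟨W, h, fun _ _ => rfl, by simpa using hB⟩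
    | succ j ih =>
      obtain ⟨V, hV, hVF, hVB⟩ := ih
      have ht : ∫ t in 0..1, G (V t) ≤ 0 := (hVF G hG).trans_le hG0
      refine ⟨double V, hV.two_copies, fun F hF => (hV.integral_double hF).trans (hVF F hF),
        fun x h0 h1 => ?_⟩
      have hd := hV.two_copies.tame
      rw [pow_succ]
      rcases le_total x (1 / 2) with hx | hx
      · have a1 := (hVB (2 * x) (by linarith) (by linarith)).1
        have a2 := (hVB (2 * x) (by linarith) (by linarith)).2
        rw [hd.integral_add hG h0 hx (by norm_num) le_rfl, integral_double_left h0 hx,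
          integral_double_half' hx, integral_double_right le_rfl (by norm_num)]
        norm_num at a1 a2 ⊢
        constructor <;> linarith
      · have a1 := (hVB (2 * x - 1) (by linarith) (by linarith)).1
        have a2 := (hVB (2 * x - 1) (by linarith) (by linarith)).2
        rw [hd.integral_add hG le_rfl (by norm_num) hx h1,
          integral_double_left (by norm_num) le_rfl, integral_double_half hx,
          integral_double_right hx h1]
        norm_num at a1 a2 ⊢
        constructor <;> linarith
  obtain ⟨j, hj⟩ := exists_pow_lt_of_lt_one (show 0 < η / (B + 1) by positivity)
    (show (1 / 2 : ℝ) < 1 by norm_num)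
  obtain ⟨V, hV, hVF, hVB⟩ := key j
  have hle : B * (1 / 2) ^ j ≤ η := by
    rw [lt_div_iff₀ (by positivity)] at hj
    have : (0 : ℝ) < (1 / 2) ^ j := by positivity
    nlinarith
  exact ⟨V, hV, hVF, fun x h0 h1 => ⟨(hVB x h0 h1).1.trans hle, (hVB x h0 h1).2.trans hle⟩⟩

/-- The basic step of the construction: the value `u` on two margins of total length `ε`, and small
copies of `l * W` between them. If `u` lies below the tangent line at `l`, the copies can be joined
to the margins; the homogenization gives the result the point of tangency `1` again. -/
theorem IsPiece.exists_step {p Q u l ε : ℝ} {W : ℝ → ℝ} (h : IsPiece p Q 1 W 0 1) (hu : 0 < u)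
    (hl : 0 < l) (hε : 0 < ε) (hε1 : ε < 1) (hgu : tangentGap p Q 1 u < 0)
    (hgl : tangentGap p Q l u ≤ 0) (hW : ∫ t in 0..1, tangentGap p Q 1 (l * W t) ≤ 0) :
    ∃ V : ℝ → ℝ, IsPiece p Q 1 V 0 1 ∧ ∀ F : ℝ → ℝ, IsGauge F →
      ∫ t in 0..1, F (V t) = ε * F u + (1 - ε) * ∫ t in 0..1, F (l * W t) := by
  have hg := isGauge_tangentGap p Q 1
  obtain ⟨V, hV, hVF, hVB⟩ := h.exists_homogenized (hg.comp_mul hl) hW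
    (show 0 < ε / 2 * -tangentGap p Q 1 u from mul_pos (by linarith) (by linarith))
  have hr : 0 < 1 - ε := by linarith
  set d := ε / 2 / (1 - ε)
  have hrd : (1 - ε) * d = ε / 2 := mul_div_cancel₀ _ hr.ne'
  have hM := hV.copy (d := d) one_pos hl hr
  rw [hrd, mul_one, show ε / 2 + (1 - ε) = 1 - ε / 2 by ring] at hM
  set M := copyAt l (1 - ε) d V
  have hA := (hM.join hl (isPiece_const hl hu hgl (1 - ε / 2) 1) (by linarith) (by linarith))
  have hX := (isPiece_const hl hu hgl 0 (ε / 2)).join hl hA (by linarith) (by linarith)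
  set X := joinAt (ε / 2) (fun _ => u) (joinAt (1 - ε / 2) M fun _ => u)
  -- integrals of `X` over parts of the left margin, the middle and the right margin
  have iL : ∀ F : ℝ → ℝ, ∀ y z, y ≤ z → z ≤ ε / 2 → ∫ t in y..z, F (X t) = (z - y) * F u := by
    intro F y z h1 h2
    rw [integral_joinAt_left h1 h2, intervalIntegral.integral_const, smul_eq_mul]
  have iR : ∀ F : ℝ → ℝ, ∀ y z, y ≤ z → 1 - ε / 2 ≤ y → ∫ t in y..z, F (X t) = (z - y) * F u := by
    intro F y z h1 h2
    rw [integral_joinAt_right h1 (by linarith), integral_joinAt_right h1 h2,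
      intervalIntegral.integral_const, smul_eq_mul]
  have iM : ∀ F : ℝ → ℝ, ∀ y z, y ≤ z → ε / 2 ≤ y → z ≤ 1 - ε / 2 → ∫ t in y..z, F (X t) =
      (1 - ε) * ∫ t in (y / (1 - ε) - d)..(z / (1 - ε) - d), F (l * V t) := by
    intro F y z h1 h2 h3
    rw [integral_joinAt_right h1 h2, integral_joinAt_left h1 h3, integral_copyAt hr]
  have d0 : ε / 2 / (1 - ε) - d = 0 := sub_self _
  have d1 : (1 - ε / 2) / (1 - ε) - d = 1 := by
    rw [← sub_div, div_eq_one_iff_eq hr.ne']; ring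
  have dlo : ∀ y, ε / 2 ≤ y → 0 ≤ y / (1 - ε) - d := fun y hy =>
    d0.ge.trans (sub_le_sub_right (div_le_div_of_nonneg_right hy hr.le) d)
  have dhi : ∀ y, y ≤ 1 - ε / 2 → y / (1 - ε) - d ≤ 1 := fun y hy =>
    (sub_le_sub_right (div_le_div_of_nonneg_right hy hr.le) d).trans d1.le
  have tot : ∫ t in (ε / 2)..(1 - ε / 2), tangentGap p Q 1 (X t) ≤ 0 := by
    rw [iM _ _ _ (by linarith) le_rfl le_rfl, d0, d1]
    have := hVF _ (hg.comp_mul hl)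
    rw [this]
    exact mul_nonpos_of_nonneg_of_nonpos hr.le hW
  have hη : 0 < ε / 2 * -tangentGap p Q 1 u := mul_pos (by linarith) (by linarith)
  refine ⟨X, ⟨hX.tame, hX.rh, fun x hx hx1 => ?_, fun x hx hx1 => ?_⟩, fun F hF => ?_⟩
  · rcases le_total x (ε / 2) with c1 | c1
    · rw [iL _ _ _ hx c1]
      exact mul_nonpos_of_nonneg_of_nonpos (by linarith) hgu.le
    rw [hX.tame.integral_add hg le_rfl (by linarith) c1 hx1, iL _ _ _ (by linarith) le_rfl]
    rcases le_total x (1 - ε / 2) with c2 | c2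
    · rw [iM _ _ _ c1 le_rfl c2, d0]
      have := (hVB _ (dlo x c1) (dhi x c2)).1
      nlinarith
    · rw [hX.tame.integral_add hg (by linarith) (by linarith) c2 hx1, iR _ _ _ c2 le_rfl]
      have := mul_nonpos_of_nonneg_of_nonpos (sub_nonneg.2 c2) hgu.le
      linarith
  · rcases le_total (1 - ε / 2) x with c1 | c1
    · rw [iR _ _ _ hx1 c1]
      exact mul_nonpos_of_nonneg_of_nonpos (by linarith) hgu.le
    rw [hX.tame.integral_add hg hx c1 (by linarith) le_rfl, iR _ _ _ (by linarith) le_rfl]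
    rcases le_total (ε / 2) x with c2 | c2
    · rw [iM _ _ _ c1 c2 le_rfl, d1]
      have := (hVB _ (dlo x c2) (dhi x c1)).2
      nlinarith
    · rw [hX.tame.integral_add hg hx c2 (by linarith) (by linarith), iL _ _ _ c2 le_rfl]
      have := mul_nonpos_of_nonneg_of_nonpos (sub_nonneg.2 c2) hgu.le
      linarith
  · rw [hX.tame.integral_add hF le_rfl (by linarith : 0 ≤ ε / 2) (by linarith) le_rfl,
      hX.tame.integral_add hF (by linarith) (by linarith : ε / 2 ≤ 1 - ε / 2) (by linarith) le_rfl,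
      iL _ _ _ (by linarith) le_rfl, iR _ _ _ (by linarith) le_rfl,
      iM _ _ _ (by linarith) le_rfl le_rfl, d0, d1, hVF _ (hF.comp_mul hl)]
    ring

/-! ### Pieces with nearly extremal moments -/

/-- Iterating the basic step drives every moment to the fixed point of an affine recursion. -/
theorem exists_piece_iterate {p Q u l ε τ Y Z : ℝ} (hp : 1 < p) (hQ : 1 < Q) (hu : 0 < u)
    (hl : 0 < l) (hε : 0 < ε) (hε1 : ε < 1) (hul : ε * u + (1 - ε) * l = 1)
    (hgu : tangentGap p Q 1 u < 0) (hgl : tangentGap p Q l u ≤ 0)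
    (hY : ε * u ^ p = (1 - (1 - ε) * l ^ p) * Y) (hZ : ε * u ^ τ = (1 - (1 - ε) * l ^ τ) * Z)
    (hY1 : 1 ≤ Y) (hYQ : l ^ p * Y - p * Q ^ p * l + (p - 1) * Q ^ p ≤ 0) (j : ℕ) :
    ∃ W : ℝ → ℝ, IsPiece p Q 1 W 0 1 ∧ ∫ t in 0..1, W t = 1 ∧
      ∫ t in 0..1, W t ^ p = Y - ((1 - ε) * l ^ p) ^ j * (Y - 1) ∧
      ∫ t in 0..1, W t ^ τ = Z - ((1 - ε) * l ^ τ) ^ j * (Z - 1) := by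
  have hr : 0 < 1 - ε := by linarith
  induction j with
  | zero =>
    refine ⟨fun _ => 1, isPiece_const one_pos one_pos ?_ 0 1, by simp, by simp, by simp⟩
    rw [tangentGap_self one_pos, Real.one_rpow, mul_one]
    linarith [IsContactRatio.one_lt_rpow hp hQ]
  | succ j ih =>
    obtain ⟨W, hW, h1, hWp, hWτ⟩ := ih
    have hmul : ∀ e : ℝ, ∫ t in 0..1, (l * W t) ^ e = l ^ e * ∫ t in 0..1, W t ^ e := by
      intro e
      rw [← intervalIntegral.integral_const_mul]
      refine intervalIntegral.integral_congr fun t _ => ?_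
      exact Real.mul_rpow hl.le (hW.tame.pos t).le
    have ip := hW.tame.intervalIntegrable ((isGauge_rpow p).comp_mul hl) le_rfl zero_le_one le_rfl
    have i1 := hW.tame.intervalIntegrable (isGauge_id.comp_mul hl) le_rfl zero_le_one le_rfl
    have hYj : Y - ((1 - ε) * l ^ p) ^ j * (Y - 1) ≤ Y := by
      have : 0 ≤ ((1 - ε) * l ^ p) ^ j * (Y - 1) := mul_nonneg (by positivity) (by linarith)
      linarith
    have hgW : ∫ t in 0..1, tangentGap p Q 1 (l * W t) ≤ 0 := by
      have e : ∫ t in 0..1, tangentGap p Q 1 (l * W t) =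
          (∫ t in 0..1, (l * W t) ^ p) - p * Q ^ p * (∫ t in 0..1, l * W t) +
            (p - 1) * Q ^ p := by
        simp only [tangentGap, Real.one_rpow, mul_one]
        rw [intervalIntegral.integral_add (ip.sub (i1.const_mul _)) intervalIntegrable_const,
          intervalIntegral.integral_sub ip (i1.const_mul _), intervalIntegral.integral_const_mul]
        simp
      rw [e, hmul, intervalIntegral.integral_const_mul, h1, hWp, mul_one]
      have : l ^ p * (Y - ((1 - ε) * l ^ p) ^ j * (Y - 1)) ≤ l ^ p * Y := by gcongr
      linarith
    obtain ⟨V, hV, hVF⟩ := hW.exists_step hu hl hε hε1 hgu hgl hgW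
    refine ⟨V, hV, ?_, ?_, ?_⟩
    · rw [hVF _ isGauge_id, intervalIntegral.integral_const_mul, h1, mul_one, hul]
    · rw [hVF _ (isGauge_rpow p), hmul, hWp, hY]
      ring
    · rw [hVF _ (isGauge_rpow τ), hmul, hWτ, hZ]
      ring

section StepAsymptotics

open Filter Topology

/-- The level `l` for which the margins of total length `ε` and value `u` leave the mean `1`. -/
noncomputable def stepLevel (u ε : ℝ) : ℝ := (1 - ε * u) / (1 - ε)

theorem hasDerivAt_stepLevel_rpow (u e : ℝ) :
    HasDerivAt (fun ε => (1 - ε) * stepLevel u ε ^ e) (-(1 - e * (1 - u))) 0 := by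
  have a : HasDerivAt (fun ε : ℝ => 1 - ε * u) (-u) 0 := by
    simpa using ((hasDerivAt_id (0 : ℝ)).mul_const u).const_sub 1
  have b : HasDerivAt (fun ε : ℝ => 1 - ε) (-1) 0 := by
    simpa using (hasDerivAt_id (0 : ℝ)).const_sub 1
  have c : HasDerivAt (stepLevel u) (1 - u) 0 := by
    refine (a.div b (by norm_num)).congr_deriv ?_
    norm_num
    ring
  have h0 : stepLevel u 0 = 1 := by simp [stepLevel]
  refine (b.mul (c.rpow_const (p := e) (Or.inl (by rw [h0]; exact one_ne_zero)))).congr_deriv ?_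
  rw [h0]
  simp
  ring

theorem tendsto_stepLevel (u : ℝ) : Tendsto (stepLevel u) (𝓝[>] 0) (𝓝 1) := by
  have h0 : stepLevel u 0 = 1 := by simp [stepLevel]
  have : ContinuousAt (stepLevel u) 0 := by
    unfold stepLevel
    exact ContinuousAt.div (by fun_prop) (by fun_prop) (by norm_num)
  rw [← h0]
  exact this.tendsto.mono_left nhdsWithin_le_nhds

theorem tendsto_step_quotient (u e : ℝ) :
    Tendsto (fun ε => (1 - (1 - ε) * stepLevel u ε ^ e) / ε) (𝓝[>] 0) (𝓝 (1 - e * (1 - u))) := by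
  have h := (hasDerivAt_iff_tendsto_slope.1 (hasDerivAt_stepLevel_rpow u e)).mono_left
    (nhdsWithin_mono 0 fun x (hx : 0 < x) => (ne_of_gt hx : x ≠ 0))
  have := h.neg
  rw [neg_neg] at this
  refine this.congr fun ε => ?_
  have h0 : stepLevel u 0 = 1 := by simp [stepLevel]
  rw [slope_def_field, h0, Real.one_rpow]
  ring

/-- The fixed point of the recursion for the moment of order `e`. -/
noncomputable def stepMoment (u e ε : ℝ) : ℝ := ε * u ^ e / (1 - (1 - ε) * stepLevel u ε ^ e)

theorem tendsto_stepMoment {u e : ℝ} (h : 0 < 1 - e * (1 - u)) :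
    Tendsto (stepMoment u e) (𝓝[>] 0) (𝓝 (u ^ e / (1 - e * (1 - u)))) := by
  refine ((tendsto_const_nhds (x := u ^ e)).div (tendsto_step_quotient u e) h.ne').congr' ?_
  filter_upwards [self_mem_nhdsWithin] with ε hε
  have hε : 0 < ε := hε
  rw [stepMoment, Pi.div_apply, div_div_eq_mul_div, mul_comm]

theorem eventually_ratio_lt_one {u e : ℝ} (h : 0 < 1 - e * (1 - u)) :
    ∀ᶠ ε in 𝓝[>] 0, (1 - ε) * stepLevel u ε ^ e < 1 := by
  filter_upwards [self_mem_nhdsWithin, (tendsto_step_quotient u e).eventually (lt_mem_nhds h)]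
    with ε hε h1
  have := mul_pos h1 hε
  rw [div_mul_cancel₀ _ (ne_of_gt hε)] at this
  linarith

/-- With margins of a fixed width `ε`, the moments of the iterates converge to `stepMoment u e ε`,
and these tend to `u ^ e / (1 - e * (1 - u))` as `ε → 0`, the moments of a power weight. -/
theorem exists_piece_of_level {p Q u τ : ℝ} (hp : 1 < p) (hQ : 1 < Q) (hu : 0 < u) (hu1 : u ≠ 1)
    (hgu : tangentGap p Q 1 u < 0) (hup : 0 < 1 - p * (1 - u)) (huτ : 0 < 1 - τ * (1 - u))
    {y z : ℝ} (hy : y < u ^ p / (1 - p * (1 - u))) (hz : z < u ^ τ / (1 - τ * (1 - u))) :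
    ∃ W : ℝ → ℝ, IsPiece p Q 1 W 0 1 ∧ ∫ t in 0..1, W t = 1 ∧
      y ≤ ∫ t in 0..1, W t ^ p ∧ z ≤ ∫ t in 0..1, W t ^ τ := by
  have hl := tendsto_stepLevel u
  have hY := tendsto_stepMoment hup
  have hZ := tendsto_stepMoment huτ
  have hY1 : 1 < u ^ p / (1 - p * (1 - u)) := by
    rw [one_lt_div hup]
    have := one_add_mul_self_lt_rpow_one_add (s := u - 1) (by linarith) (sub_ne_zero.2 hu1) hp
    rw [add_sub_cancel] at this
    linarith
  have hlp : ∀ e : ℝ, Tendsto (fun ε => stepLevel u ε ^ e) (𝓝[>] 0) (𝓝 1) := fun e => by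
    have := hl.rpow_const (p := e) (Or.inl one_ne_zero)
    rwa [Real.one_rpow] at this
  have hgl : Tendsto (fun ε => tangentGap p Q (stepLevel u ε) u) (𝓝[>] 0)
      (𝓝 (tangentGap p Q 1 u)) := by
    have := ((tendsto_const_nhds (x := u ^ p)).sub
      (((hlp (p - 1)).const_mul (p * Q ^ p)).mul_const u)).add ((hlp p).const_mul ((p - 1) * Q ^ p))
    simpa [tangentGap] using this
  have hYQ : Tendsto (fun ε => stepLevel u ε ^ p * stepMoment u p ε -
      p * Q ^ p * stepLevel u ε + (p - 1) * Q ^ p) (𝓝[>] 0)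
      (𝓝 (1 * (u ^ p / (1 - p * (1 - u))) - p * Q ^ p * 1 + (p - 1) * Q ^ p)) :=
    (((hlp p).mul hY).sub (hl.const_mul _)).add_const _
  have hneg : 1 * (u ^ p / (1 - p * (1 - u))) - p * Q ^ p * 1 + (p - 1) * Q ^ p < 0 := by
    have : u ^ p / (1 - p * (1 - u)) < Q ^ p := by
      rw [div_lt_iff₀ hup]
      simp only [tangentGap, Real.one_rpow] at hgu
      linarith
    linarith
  have hpos : ∀ᶠ ε : ℝ in 𝓝[>] 0, 0 < ε := self_mem_nhdsWithin
  have hε1 : ∀ᶠ ε : ℝ in 𝓝[>] 0, ε < 1 :=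
    nhdsWithin_le_nhds (gt_mem_nhds one_pos)
  obtain ⟨ε, hε0, hε1, el, eY1, egl, eYQ, ep, eτ, ey, ez⟩ :=
    (hpos.and <| hε1.and <|
      (hl.eventually (lt_mem_nhds one_pos)).and <| (hY.eventually (lt_mem_nhds hY1)).and <|
      (hgl.eventually (gt_mem_nhds hgu)).and <| (hYQ.eventually (gt_mem_nhds hneg)).and <|
      (eventually_ratio_lt_one hup).and <| (eventually_ratio_lt_one huτ).and <|
      (hY.eventually (lt_mem_nhds hy)).and (hZ.eventually (lt_mem_nhds hz))).exists
  have hr : 0 < 1 - ε := by linarith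
  have key := exists_piece_iterate (τ := τ) (Y := stepMoment u p ε) (Z := stepMoment u τ ε) hp hQ
    hu el hε0 hε1 ?_ hgu egl.le ?_ ?_ eY1.le eYQ.le
  · have lim : ∀ e : ℝ, (1 - ε) * stepLevel u ε ^ e < 1 →
        Tendsto (fun j : ℕ => stepMoment u e ε - ((1 - ε) * stepLevel u ε ^ e) ^ j *
          (stepMoment u e ε - 1)) atTop (𝓝 (stepMoment u e ε)) := by
      intro e he
      have := (tendsto_pow_atTop_nhds_zero_of_lt_one (r := (1 - ε) * stepLevel u ε ^ e)
        (by positivity) he).mul_const (stepMoment u e ε - 1)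
      simpa using this.const_sub (stepMoment u e ε)
    obtain ⟨j, hj1, hj2⟩ := (((lim p ep).eventually (lt_mem_nhds ey)).and
      ((lim τ eτ).eventually (lt_mem_nhds ez))).exists
    obtain ⟨W, hW, h1, h2, h3⟩ := key j
    exact ⟨W, hW, h1, by rw [h2]; exact hj1.le, by rw [h3]; exact hj2.le⟩
  · rw [stepLevel, mul_div_cancel₀ _ hr.ne']
    ring
  · rw [stepMoment, mul_div_cancel₀ _ (by linarith)]
  · rw [stepMoment, mul_div_cancel₀ _ (by linarith)]

/-- At the critical exponent `τ = 1 / (1 - k)`, letting `u` tend to the contact point `k` makes the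
moment of order `τ` arbitrarily large, while that of order `p` tends to `Q ^ p`. -/
theorem IsContactRatio.exists_piece {p Q k τ : ℝ} (h : IsContactRatio p Q k) (hp : 1 < p)
    (hQ : 1 < Q) (hτ : τ * (1 - k) = 1) {y : ℝ} (hy : y < Q ^ p) (z : ℝ) :
    ∃ W : ℝ → ℝ, IsPiece p Q 1 W 0 1 ∧ ∫ t in 0..1, W t = 1 ∧
      y ≤ ∫ t in 0..1, W t ^ p ∧ z ≤ ∫ t in 0..1, W t ^ τ := by
  have hk1 := h.ne_one hp hQ
  have hd := h.den_pos
  set U : ℝ → ℝ := fun t => k + t * (1 - k)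
  have hU : Tendsto U (𝓝[>] 0) (𝓝 k) := by
    have : Continuous U := by fun_prop
    have h0 := this.tendsto 0
    simp only [U, zero_mul, add_zero] at h0
    exact h0.mono_left nhdsWithin_le_nhds
  have hden : Tendsto (fun t => 1 - p * (1 - U t)) (𝓝[>] 0) (𝓝 (1 - p * (1 - k))) :=
    ((hU.const_sub 1).const_mul p).const_sub 1
  have hdpos : 0 < 1 - p * (1 - k) := by linarith
  have hY : Tendsto (fun t => U t ^ p / (1 - p * (1 - U t))) (𝓝[>] 0) (𝓝 (Q ^ p)) := by
    have := (hU.rpow_const (p := p) (Or.inl h.pos.ne')).div hden hdpos.ne'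
    rw [h.eq, show 1 - p * (1 - k) = p * k - p + 1 by ring, mul_div_cancel_right₀ _ hd.ne'] at this
    exact this
  have hτU : ∀ t, 1 - τ * (1 - U t) = t := fun t => by
    have : τ * (1 - U t) = τ * (1 - k) * (1 - t) := by simp only [U]; ring
    rw [this, hτ]; ring
  have hZ : Tendsto (fun t => U t ^ τ / t) (𝓝[>] 0) atTop :=
    (hU.rpow_const (p := τ) (Or.inl h.pos.ne')).pos_mul_atTop (Real.rpow_pos_of_pos h.pos τ)
      tendsto_inv_nhdsGT_zero
  have hpos : ∀ᶠ t : ℝ in 𝓝[>] 0, 0 < t := self_mem_nhdsWithin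
  have ht1 : ∀ᶠ t : ℝ in 𝓝[>] 0, t < 1 := nhdsWithin_le_nhds (gt_mem_nhds one_pos)
  obtain ⟨t, ht0, ht1, e1, e2, e3, e4⟩ :=
    (hpos.and <| ht1.and <|
      (hU.eventually (lt_mem_nhds h.pos)).and <| (hden.eventually (lt_mem_nhds hdpos)).and <|
      (hY.eventually (lt_mem_nhds hy)).and (hZ.eventually_gt_atTop z)).exists
  refine exists_piece_of_level hp hQ e1 ?_ (h.tangentGap_neg hp hQ ht0 ht1.le) e2
    (by rw [hτU]; exact ht0) e3 (by rw [hτU]; exact e4)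
  intro he
  have : (1 - t) * (1 - k) = 0 := by
    have : U t = 1 := he
    simp only [U] at this
    linarith
  rcases mul_eq_zero.1 this with h1 | h1
  · linarith
  · exact hk1 (by linarith)

end StepAsymptotics

/-! ### A weight on the line made of pieces -/

/-- The function equal to the translate of `W |i|` on `[i, i + 1)` for every integer `i`. -/
noncomputable def glue (W : ℕ → ℝ → ℝ) (x : ℝ) : ℝ := W ⌊x⌋.natAbs (Int.fract x)

theorem measurable_glue {W : ℕ → ℝ → ℝ} (hW : ∀ j, Measurable (W j)) : Measurable (glue W) := by
  have h : Measurable fun z : ℕ × ℝ => W z.1 z.2 := measurable_from_prod_countable_right hW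
  exact h.comp (((measurable_of_countable Int.natAbs).comp Int.measurable_floor).prodMk
    measurable_fract)

theorem glue_eq (W : ℕ → ℝ → ℝ) (i : ℤ) {x : ℝ} (hx : x ∈ Ico (i : ℝ) (i + 1)) :
    glue W x = copyAt 1 1 i (W i.natAbs) x := by
  have h : ⌊x⌋ = i := Int.floor_eq_iff.2 hx
  rw [glue, copyAt, Int.fract, h, div_one, one_mul]

theorem isPiece_glue_unit {p Q : ℝ} {W : ℕ → ℝ → ℝ} (hW : ∀ j, IsPiece p Q 1 (W j) 0 1) (i : ℤ) :
    IsPiece p Q 1 (glue W) i (i + 1) := by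
  have h := (hW i.natAbs).copy (d := i) one_pos one_pos one_pos
  rw [one_mul, one_mul] at h
  exact h.congr (measurable_glue fun j => (hW j).tame.measurable)
    (fun x => (hW _).tame.pos _) fun x hx => glue_eq W i hx

theorem isPiece_glue {p Q : ℝ} {W : ℕ → ℝ → ℝ} (hW : ∀ j, IsPiece p Q 1 (W j) 0 1) (i : ℤ)
    (N : ℕ) : IsPiece p Q 1 (glue W) i (i + (N + 1)) := by
  induction N with
  | zero => simpa using isPiece_glue_unit hW i
  | succ N ih =>
    have h := isPiece_glue_unit hW (i + (N + 1))
    push_cast at h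
    have h2 := ih.join one_pos h (by linarith [N.cast_nonneg (α := ℝ)]) (by linarith)
    have e : joinAt ((i : ℝ) + (N + 1)) (glue W) (glue W) = glue W := by
      funext x; simp [joinAt]
    rw [e] at h2
    push_cast
    rwa [add_assoc] at h2

theorem integral_glue (W : ℕ → ℝ → ℝ) (F : ℝ → ℝ) (j : ℕ) :
    ∫ t in (j : ℝ)..(j + 1), F (glue W t) = ∫ t in 0..1, F (W j t) := by
  have h : ∫ t in (j : ℝ)..(j + 1), F (glue W t) =
      ∫ t in (j : ℝ)..(j + 1), F (copyAt 1 1 (j : ℤ) (W (j : ℤ).natAbs) t) :=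
    integral_congr_Ico (by linarith) fun x hx => by rw [glue_eq W (j : ℤ) (by simpa using hx)]
  rw [h, integral_copyAt one_pos]
  simp

/-! ### Weights on the line as weights on the functions from a one-point type -/

theorem avg_comp_eval (f : ℝ → ℝ) (a b : Fin 1 → ℝ) :
    avg volume (Icc a b) (fun x => f (x 0)) =
      (∫⁻ t in Ioc (a 0) (b 0), ENNReal.ofReal (f t)) / ENNReal.ofReal (b 0 - a 0) := by
  have hmp := volume_preserving_funUnique (Fin 1) ℝ
  have he := (MeasurableEquiv.funUnique (Fin 1) ℝ).measurableEmbedding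
  have hpre : Icc a b = (MeasurableEquiv.funUnique (Fin 1) ℝ) ⁻¹' Icc (a 0) (b 0) := by
    ext x
    simp [Pi.le_def, MeasurableEquiv.funUnique]
  have h1 : ∫⁻ x in Icc a b, ENNReal.ofReal (f (x 0)) =
      ∫⁻ t in Icc (a 0) (b 0), ENNReal.ofReal (f t) := by
    rw [hpre]
    exact hmp.setLIntegral_comp_preimage_emb he (fun t => ENNReal.ofReal (f t)) _
  have h2 : (volume : Measure (Fin 1 → ℝ)) (Icc a b) = ENNReal.ofReal (b 0 - a 0) := by
    rw [Real.volume_Icc_pi]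
    simp
  rw [avg, h1, h2, setLIntegral_congr Ioc_ae_eq_Icc]

theorem avg_comp_eval_eq_ofReal {f : ℝ → ℝ} (hf : ∀ t, 0 ≤ f t) {a b : Fin 1 → ℝ}
    (hab : a 0 < b 0) (hi : IntervalIntegrable f volume (a 0) (b 0)) :
    avg volume (Icc a b) (fun x => f (x 0)) =
      ENNReal.ofReal ((∫ t in (a 0)..(b 0), f t) / (b 0 - a 0)) := by
  rw [avg_comp_eval f a b, ENNReal.ofReal_div_of_pos (by linarith),
    intervalIntegral.integral_of_le hab.le, ofReal_integral_eq_lintegral_ofReal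
      ((intervalIntegrable_iff_integrableOn_Ioc_of_le hab.le).1 hi)
      (Filter.Eventually.of_forall hf)]

theorem unit_box_mem (j : ℕ) :
    Icc (fun _ : Fin 1 => (j : ℝ)) (fun _ => (j : ℝ) + 1) ∈
      boxes (volume : Measure (Fin 1 → ℝ)) := by
  refine ⟨⟨_, _, fun _ => by linarith, rfl⟩, ?_⟩
  rw [Real.volume_Icc_pi]
  simp

theorem isWeight_comp_eval {w : ℝ → ℝ} (hpos : ∀ t, 0 < w t)
    (hi : ∀ c d, c ≤ d → IntervalIntegrable w volume c d) :
    IsWeight (volume : Measure (Fin 1 → ℝ)) (fun x => w (x 0)) := by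
  refine ⟨fun x => ?_, Filter.Eventually.of_forall fun x => hpos _⟩
  have hmp := volume_preserving_funUnique (Fin 1) ℝ
  have he := (MeasurableEquiv.funUnique (Fin 1) ℝ).measurableEmbedding
  refine ⟨(MeasurableEquiv.funUnique (Fin 1) ℝ) ⁻¹' Ioc (x 0 - 1) (x 0 + 1), ?_, ?_⟩
  · have hc : Continuous fun y : Fin 1 → ℝ => y 0 := continuous_apply 0
    exact hc.continuousAt.preimage_mem_nhds (Ioc_mem_nhds (by linarith) (by linarith))
  · exact (hmp.integrableOn_comp_preimage he).2
      ((intervalIntegrable_iff_integrableOn_Ioc_of_le (by linarith)).1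
        (hi (x 0 - 1) (x 0 + 1) (by linarith)))

/-! ### Sharpness -/

/-- At the critical exponent `τ = 1 / (1 - k)` there is a weight on the line with the given reverse
Hölder characteristic whose averages of order `τ` over boxes with mean `1` are unbounded. -/
theorem IsContactRatio.exists_weight {p Q k τ : ℝ} (h : IsContactRatio p Q k) (hp : 1 < p)
    (hQ : 1 < Q) (hτ : τ * (1 - k) = 1) :
    ∃ w : (Fin 1 → ℝ) → ℝ, IsWeight volume w ∧ (∀ x, 0 < w x) ∧
      strongRHChar volume p w = ENNReal.ofReal Q ∧ ∀ j : ℕ, ∃ R ∈ boxes volume,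
        avg volume R w = 1 ∧ (j : ℝ≥0∞) ≤ avg volume R (fun x => w x ^ τ) := by
  have hp0 : 0 < p := by linarith
  have hQ0 : 0 < Q := by linarith
  choose W hW hW1 hWp hWτ using fun j : ℕ => h.exists_piece hp hQ hτ
    (y := Q ^ p - 1 / ((j : ℝ) + 1)) (sub_lt_self _ (by positivity)) (j : ℝ)
  have hpos : ∀ t, 0 < glue W t := fun t => (hW _).tame.pos _
  have hbig : ∀ c d : ℝ, c ≤ d → ∃ a b : ℝ, a ≤ c ∧ d ≤ b ∧ IsPiece p Q 1 (glue W) a b := by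
    intro c d hcd
    obtain ⟨N, hN⟩ := exists_nat_ge (d - ⌊c⌋)
    exact ⟨_, _, Int.floor_le c, by linarith, isPiece_glue hW ⌊c⌋ N⟩
  have hint : ∀ F : ℝ → ℝ, IsGauge F → ∀ c d, c ≤ d →
      IntervalIntegrable (fun t => F (glue W t)) volume c d := by
    intro F hF c d hcd
    obtain ⟨a, b, ha, hb, hP⟩ := hbig c d hcd
    exact hP.tame.intervalIntegrable hF ha hcd hb
  have hnn : ∀ (e : ℝ) t, 0 ≤ glue W t ^ e := fun e t => Real.rpow_nonneg (hpos t).le _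
  have havg : ∀ (e : ℝ) (j : ℕ), avg volume (Icc (fun _ : Fin 1 => (j : ℝ)) fun _ => (j : ℝ) + 1)
      (fun x => glue W (x 0) ^ e) = ENNReal.ofReal (∫ t in 0..1, W j t ^ e) := by
    intro e j
    rw [avg_comp_eval_eq_ofReal (f := fun t => glue W t ^ e) (hnn e) (by simp)
      (hint _ (isGauge_rpow e) _ _ (by simp)), integral_glue W (fun y => y ^ e) j]
    simp
  have havg1 : ∀ j : ℕ, avg volume (Icc (fun _ : Fin 1 => (j : ℝ)) fun _ => (j : ℝ) + 1)
      (fun x => glue W (x 0)) = 1 := by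
    intro j
    have := havg 1 j
    simp only [Real.rpow_one, hW1, ENNReal.ofReal_one] at this
    exact this
  refine ⟨fun x => glue W (x 0), isWeight_comp_eval hpos (hint _ isGauge_id), fun x => hpos _,
    le_antisymm ?_ ?_, fun j => ⟨_, unit_box_mem j, havg1 j, ?_⟩⟩
  · refine iSup₂_le fun R hR => ?_
    obtain ⟨⟨a, b, hab, rfl⟩, -⟩ := hR
    have hab0 := hab 0
    have hi1 := hint _ isGauge_id _ _ hab0.le
    have hip := hint _ (isGauge_rpow p) _ _ hab0.le
    obtain ⟨a', b', ha', hb', hP⟩ := hbig (a 0) (b 0) hab0.le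
    obtain ⟨m, hm, hgap⟩ := hP.rh (a 0) (b 0) ha' hab0.le hb'
    have hd : 0 < b 0 - a 0 := by linarith
    have e : ∫ t in (a 0)..(b 0), tangentGap p Q m (glue W t) =
        (∫ t in (a 0)..(b 0), glue W t ^ p) -
          p * Q ^ p * m ^ (p - 1) * (∫ t in (a 0)..(b 0), glue W t) +
            (b 0 - a 0) * ((p - 1) * Q ^ p * m ^ p) := by
      simp only [tangentGap]
      rw [intervalIntegral.integral_add (hip.sub (hi1.const_mul _)) intervalIntegrable_const,
        intervalIntegral.integral_sub hip (hi1.const_mul _), intervalIntegral.integral_const_mul]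
      simp only [intervalIntegral.integral_const, smul_eq_mul]
    have hA : 0 < (∫ t in (a 0)..(b 0), glue W t) / (b 0 - a 0) :=
      div_pos (intervalIntegral.intervalIntegral_pos_of_pos hi1 hpos hab0) hd
    have hB : 0 ≤ (∫ t in (a 0)..(b 0), glue W t ^ p) / (b 0 - a 0) :=
      div_nonneg (intervalIntegral.integral_nonneg hab0.le fun t _ => hnn p t) hd.le
    have key := le_of_tangentGap_nonpos (B := (∫ t in (a 0)..(b 0), glue W t ^ p) / (b 0 - a 0))
      hp hQ0 hm hA.le (by
        rw [e] at hgap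
        have := div_nonpos_of_nonpos_of_nonneg hgap hd.le
        rw [add_div, sub_div, mul_div_cancel_left₀ _ hd.ne', mul_div_assoc] at this
        exact this)
    rw [avg_comp_eval_eq_ofReal (fun t => (hpos t).le) hab0 hi1,
      avg_comp_eval_eq_ofReal (f := fun t => glue W t ^ p) (hnn p) hab0 hip,
      ENNReal.ofReal_rpow_of_nonneg hB (by positivity), ← div_eq_mul_inv,
      ← ENNReal.ofReal_div_of_pos hA]
    apply ENNReal.ofReal_le_ofReal
    rw [div_le_iff₀ hA, one_div, Real.rpow_inv_le_iff_of_pos hB (by positivity) hp0,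
      Real.mul_rpow hQ0.le hA.le]
    exact key
  · -- the box `[j, j + 1]` gives at least `(Q ^ p - 1 / (j + 1)) ^ (1 / p)`
    have hlow : ∀ j : ℕ, ENNReal.ofReal (Q ^ p - 1 / ((j : ℝ) + 1)) ^ (1 / p) ≤
        strongRHChar (volume : Measure (Fin 1 → ℝ)) p (fun x => glue W (x 0)) := by
      intro j
      refine le_trans ?_ (le_iSup₂ (f := fun R (_ : R ∈ boxes volume) =>
        avg volume R (fun x : Fin 1 → ℝ => glue W (x 0) ^ p) ^ (1 / p) *
          (avg volume R fun x => glue W (x 0))⁻¹) _ (unit_box_mem j))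
      rw [havg1 j, havg p j, inv_one, mul_one]
      gcongr
      exact hWp j
    have hlim : Filter.Tendsto (fun j : ℕ => ENNReal.ofReal (Q ^ p - 1 / ((j : ℝ) + 1)) ^ (1 / p))
        Filter.atTop (nhds (ENNReal.ofReal Q)) := by
      have h1 : Filter.Tendsto (fun j : ℕ => Q ^ p - 1 / ((j : ℝ) + 1)) Filter.atTop
          (nhds (Q ^ p - 0)) := tendsto_one_div_add_atTop_nhds_zero_nat.const_sub _
      rw [sub_zero] at h1
      have h2 := ((ENNReal.continuous_rpow_const (y := 1 / p)).tendsto _).comp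
        ((ENNReal.continuous_ofReal.tendsto _).comp h1)
      rw [ENNReal.ofReal_rpow_of_nonneg (by positivity) (by positivity), ← Real.rpow_mul hQ0.le,
        mul_one_div_cancel hp0.ne', Real.rpow_one] at h2
      exact h2
    exact le_of_tendsto' hlim hlow
  · rw [havg τ j, ← ENNReal.ofReal_natCast]
    exact ENNReal.ofReal_le_ofReal (hWτ j)

theorem avg_rpow_le_one_add {w : (Fin 1 → ℝ) → ℝ} (hpos : ∀ x, 0 < w x) {e τ : ℝ}
    (h : ∀ y : ℝ, 0 < y → y ^ τ ≤ 1 + y ^ e) {R : Set (Fin 1 → ℝ)} (hR : R ∈ boxes volume) :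
    avg volume R (fun x => w x ^ τ) ≤ 1 + avg volume R (fun x => w x ^ e) := by
  have hfin : volume R ≠ ∞ := measure_box_ne_top hR
  have h1 : ∫⁻ x in R, ENNReal.ofReal (w x ^ τ) ≤
      volume R + ∫⁻ x in R, ENNReal.ofReal (w x ^ e) := by
    calc ∫⁻ x in R, ENNReal.ofReal (w x ^ τ)
        ≤ ∫⁻ x in R, (1 + ENNReal.ofReal (w x ^ e)) := lintegral_mono fun x => by
          rw [← ENNReal.ofReal_one, ← ENNReal.ofReal_add zero_le_one
            (Real.rpow_nonneg (hpos x).le _)]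
          exact ENNReal.ofReal_le_ofReal (h _ (hpos x))
      _ = _ := by
          rw [lintegral_add_left measurable_const, setLIntegral_one]
  refine (ENNReal.div_le_div_right h1 _).trans (le_of_eq ?_)
  rw [ENNReal.add_div, ENNReal.div_self hR.2.ne' hfin]
  rfl

/-- Unbounded averages of order `e` over boxes with mean `1` are incompatible with a finite bound
for their powers with a positive exponent. -/
theorem not_avg_rpow_le {w : (Fin 1 → ℝ) → ℝ} (hpos : ∀ x, 0 < w x) {e τ θ : ℝ}
    (hw : ∀ j : ℕ, ∃ R ∈ boxes volume,
      avg volume R w = 1 ∧ (j : ℝ≥0∞) ≤ avg volume R (fun x => w x ^ τ))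
    (h : ∀ y : ℝ, 0 < y → y ^ τ ≤ 1 + y ^ e) (hθ : 0 < θ) {S : ℝ≥0∞} (hS : S < ∞) :
    ¬ ∀ R ∈ boxes volume, avg volume R w = 1 → avg volume R (fun x => w x ^ e) ^ θ ≤ S := by
  intro hcon
  obtain ⟨j, hj⟩ := ENNReal.exists_nat_gt (r := 1 + S ^ (1 / θ))
    (ENNReal.add_ne_top.2 ⟨ENNReal.one_ne_top, ENNReal.rpow_ne_top_of_nonneg (by positivity) hS.ne⟩)
  obtain ⟨R, hR, h1, h2⟩ := hw j
  have h3 : avg volume R (fun x => w x ^ e) ≤ S ^ (1 / θ) := by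
    rw [one_div, ENNReal.le_rpow_inv_iff hθ]
    exact hcon R hR h1
  exact absurd (h2.trans ((avg_rpow_le_one_add hpos h hR).trans (by gcongr))) (not_le.2 hj)

theorem theorem2 (p Q : ℝ) (hp : 1 < p) (hQ : 1 < Q) :
    -- self-improvement, with constants that depend only on `p`, `Q`, `q`
    (∀ q : ℝ, 1 - sMinus p Q < q → ∃ C : ℝ≥0,
      ∀ (n : ℕ) (μ : Measure (Fin n → ℝ)) [IsLocallyFiniteMeasure μ],
        (∀ (i : Fin n) (c : ℝ), μ {x | x i = c} = 0) →
        ∀ w : (Fin n → ℝ) → ℝ, IsWeight μ w → strongRHChar μ p w = ENNReal.ofReal Q →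
          MemStrongA μ q w ∧ strongAChar μ q w ≤ C) ∧
    (∀ q : ℝ, 1 ≤ q → q < 1 / sPlus p Q → ∃ C : ℝ≥0,
      ∀ (n : ℕ) (μ : Measure (Fin n → ℝ)) [IsLocallyFiniteMeasure μ],
        (∀ (i : Fin n) (c : ℝ), μ {x | x i = c} = 0) →
        ∀ w : (Fin n → ℝ) → ℝ, IsWeight μ w → strongRHChar μ p w = ENNReal.ofReal Q →
          MemStrongRH μ q w ∧ strongRHChar μ q w ≤ C) ∧
    -- sharpness of both ranges for Lebesgue measure on the line
    (∀ q : ℝ, 1 < q → q ≤ 1 - sMinus p Q →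
      ∃ w : (Fin 1 → ℝ) → ℝ, IsWeight volume w ∧
        strongRHChar volume p w = ENNReal.ofReal Q ∧ ¬ MemStrongA volume q w) ∧
    (∀ q : ℝ, 1 / sPlus p Q ≤ q →
      ∃ w : (Fin 1 → ℝ) → ℝ, IsWeight volume w ∧
        strongRHChar volume p w = ENNReal.ofReal Q ∧ ¬ MemStrongRH volume q w) := by
  obtain ⟨hkm, hsm⟩ := sMinus_spec hp hQ
  obtain ⟨hkp, hsp⟩ := sPlus_spec hp hQ
  refine ⟨fun q hq => exists_strongAChar_le hkm hp hQ (by linarith) hq,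
    fun q hq1 hq => exists_strongRHChar_le hkp hp hQ (by linarith) hq1 ?_, fun q hq1 hq => ?_,
    fun q hq => ?_⟩
  · rw [sub_sub_cancel]
    rwa [lt_div_iff₀ hsp] at hq
  · obtain ⟨w, hw, hpos, hwQ, hj⟩ := hkm.exists_weight (τ := 1 / sMinus p Q) hp hQ (by
      rw [sub_sub_cancel, one_div_mul_cancel hsm.ne])
    refine ⟨w, hw, hwQ, fun hmem => not_avg_rpow_le hpos hj (e := -1 / (q - 1)) (θ := q - 1)
      (fun y hy => ?_) (by linarith) hmem fun R hR h1 => ?_⟩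
    · have hq0 : 0 < q - 1 := by linarith
      have hτ : 1 / sMinus p Q ≤ 0 := (one_div_neg.2 hsm).le
      have he : -1 / (q - 1) ≤ 1 / sMinus p Q := by
        rw [div_le_iff₀ hq0, one_div, ← div_eq_inv_mul, le_div_iff_of_neg hsm]
        linarith
      rcases le_total 1 y with h | h
      · linarith [Real.rpow_le_one_of_one_le_of_nonpos h hτ, Real.rpow_nonneg hy.le (-1 / (q - 1))]
      · linarith [Real.rpow_le_rpow_of_exponent_ge hy h he]
    · refine le_trans (le_of_eq ?_) (le_iSup₂ (f := fun R (_ : R ∈ boxes volume) =>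
        avg volume R w * avg volume R (fun x => w x ^ (-1 / (q - 1))) ^ (q - 1)) R hR)
      rw [h1, one_mul]
  · obtain ⟨w, hw, hpos, hwQ, hj⟩ := hkp.exists_weight (τ := 1 / sPlus p Q) hp hQ (by
      rw [sub_sub_cancel, one_div_mul_cancel hsp.ne'])
    have hτ : 0 < 1 / sPlus p Q := by positivity
    have hq0 : 0 < q := hτ.trans_le hq
    refine ⟨w, hw, hwQ, fun hmem => not_avg_rpow_le hpos hj (e := q) (θ := 1 / q)
      (fun y hy => ?_) (by positivity) hmem fun R hR h1 => ?_⟩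
    · rcases le_total 1 y with h | h
      · linarith [Real.rpow_le_rpow_of_exponent_le h hq]
      · linarith [Real.rpow_le_one hy.le h hτ.le, Real.rpow_nonneg hy.le q]
    · refine le_trans (le_of_eq ?_) (le_iSup₂ (f := fun R (_ : R ∈ boxes volume) =>
        avg volume R (fun x => w x ^ q) ^ (1 / q) * (avg volume R w)⁻¹) R hR)
      rw [h1, inv_one, mul_one]
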